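/- Let \(u_0,u_1\in C^2(\mathbb R^3)\) satisfy the decay condition \(\partial_r(r u_0)\to 0\) and \(r u_1\to 0\) as \(r=|x|\to\infty\) (compact support is not assumed). All solutions below are \(C^1\) functions satisfying their equation in the sense of distributions and attaining the given data, \(C^1\) up to the initial time; this includes all classical \(C^2\) solutions. Let \(u_{\mathrm{lin}}\) be the solution on \(\mathbb R\times\mathbb R^3\) of \(\partial_t^2u_{\mathrm{lin}}-\Delta u_{\mathrm{lin}}=0\) with \(u_{\mathrm{lin}}(0,\cdot)=u_0\), \(\partial_tu_{\mathrm{lin}}(0,\cdot)=u_1\). Write \(M_{x_0}[f](r)=\frac1{4\pi}\int_{|\xi|=1}f(x_0+r\xi)\,d\sigma(\xi)\), and consider solutions of \[\partial_t^2u-\Delta u=(\partial_tu)^2,\qquad u(0,\cdot)=u_0,\quad \partial_tu(0,\cdot)=u_1 .\tag{$*$}\] 1. Suppose there are \(x_0\in\mathbb R^3\), \(q\ge0\) and \(r_0\ge q\) with \(M_{x_0}[\partial_tu_{\mathrm{lin}}(r-q)](r)>0\) for all \(r\ge r_0\) (forward sign condition). Then \(\partial_tu\to+\infty\) in finite positive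 time, in the following sense. There are \(0<T_*<\infty\), \(0<R<\infty\) and a function \(b\) with \(b(t)\to+\infty\) as \(t\uparrow T_*\), depending only on the data, such that every solution \(u\) of \((*)\) on a cylinder \([0,T)\times\{|x|<R\}\), \(T>0\) (in particular every solution on \([0,T)\times\mathbb R^3\)), satisfies \(T\le T_*\), and for all \(0<t<T\) some value \(\partial_tu(t,x)\) with \(|x|<R\) is at least \(b(t)\); and if \(T=T_*\), then there is a point \(y\) with \(|y|<R\) such that \(\partial_tu\) is unbounded above on \(\{T_*-\varepsilon<t<T_*,\ |x-y|<\varepsilon\}\) for every \(\varepsilon>0\). 2. Suppose there are \(x_0\in\mathbb R^3\), \(q\ge0\) and \(r_0\ge q\) with \(M_{x_0}[\partial_tu_{\mathrm{lin}}(-(r-q))](r)<0\) for all \(r\ge r_0\) (backward sign condition). Then \(\partial_tu\to-\infty\) in finite negative time, in the following sense. There are \(0<T_*<\infty\), \(0<R<\infty\) and a function \(b\) with \(b(t)\to-\infty\) as \(t\downarrow-T_*\), depending only on the data, such that every solution \(u\) of \((*)\) on a cylinder \((-T,0]\times\{|x|<R\}\), \(T>0\), satisfies \(T\le T_*\) and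 for all \(-T<t<0\) some value \(\partial_tu(t,x)\) with \(|x|<R\) is at most \(b(t)\); and if \(T=T_*\), then there is a point \(y\) with \(|y|<R\) such that \(\partial_tu\) is unbounded below on \(\{-T_*<t<-T_*+\varepsilon,\ |x-y|<\varepsilon\}\) for every \(\varepsilon>0\). -/

import Mathlib

open Set Filter Topology MeasureTheory Metric
open scoped ContDiff

noncomputable section

/-- Three-dimensional Euclidean space. -/
abbrev E3 : Type := EuclideanSpace ℝ (Fin 3)

/-- The time derivative `∂ₜ u (t, x)`. -/
def timeDeriv (u : ℝ → E3 → ℝ) (t : ℝ) (x : E3) : ℝ :=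
  deriv (fun s => u s x) t

/-- The wave operator `∂ₜ² φ - Δ φ`, used on smooth functions. -/
def waveOp (φ : ℝ → E3 → ℝ) (t : ℝ) (x : E3) : ℝ :=
  iteratedDeriv 2 (fun s => φ s x) t - Laplacian.laplacian (φ t) x

/-- The radial derivative `∂ᵣ f`, where `r = |x|`. -/
def radialDeriv (f : E3 → ℝ) (x : E3) : ℝ :=
  fderiv ℝ f x (‖x‖⁻¹ • x)

/-- The spherical mean `M_{x₀}[f](r) = (4π)⁻¹ ∫_{|ξ| = 1} f (x₀ + r ξ) dσ(ξ)`, with `σ` the surface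
measure of the unit sphere. -/
def sphericalMean (x₀ : E3) (f : E3 → ℝ) (r : ℝ) : ℝ :=
  (4 * Real.pi)⁻¹ *
    ∫ ξ : sphere (0 : E3) 1, f (x₀ + r • (ξ : E3)) ∂((volume : Measure E3).toSphere)

/-- `u` is a solution of `∂ₜ² u - Δ u = G (∂ₜ u)` on `I × Ω` with data `(u₀, u₁)` at time `0`:
it is `C¹` on `I × Ω` (up to the initial time when `0` is an endpoint of the interval `I`),
satisfies the equation in the sense of distributions in the interior, and attains the data.
Every classical `C²` solution is one. -/
structure IsWaveSolution (G : ℝ → ℝ) (I : Set ℝ) (Ω : Set E3) (u₀ u₁ : E3 → ℝ)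
    (u : ℝ → E3 → ℝ) : Prop where
  contDiffOn : ContDiffOn ℝ 1 (fun p : ℝ × E3 => u p.1 p.2) (I ×ˢ Ω)
  equation : ∀ φ : ℝ → E3 → ℝ,
    ContDiff ℝ ∞ (fun p : ℝ × E3 => φ p.1 p.2) →
    HasCompactSupport (fun p : ℝ × E3 => φ p.1 p.2) →
    tsupport (fun p : ℝ × E3 => φ p.1 p.2) ⊆ interior I ×ˢ interior Ω →
    ∫ p : ℝ × E3, u p.1 p.2 * waveOp φ p.1 p.2 =
      ∫ p : ℝ × E3, G (timeDeriv u p.1 p.2) * φ p.1 p.2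
  initial : ∀ x ∈ Ω, u 0 x = u₀ x
  initial_deriv : ∀ x ∈ Ω, HasDerivWithinAt (fun t => u t x) (u₁ x) I 0

/-- The global solution of the homogeneous wave equation with data `(u₀, u₁)`. -/
def IsFreeWave (u₀ u₁ : E3 → ℝ) (v : ℝ → E3 → ℝ) : Prop :=
  IsWaveSolution (fun _ => 0) univ univ u₀ u₁ v

/-- `u` solves `∂ₜ² u - Δ u = (∂ₜ u)²` on `I × Ω` with data `(u₀, u₁)`. -/
def IsJohnSolution (I : Set ℝ) (Ω : Set E3) (u₀ u₁ : E3 → ℝ) (u : ℝ → E3 → ℝ) : Prop :=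
  IsWaveSolution (fun p => p ^ 2) I Ω u₀ u₁ u

/-- The decay condition `∂ᵣ (r u₀) → 0` and `r u₁ → 0` as `r = |x| → ∞`. -/
def DataDecay (u₀ u₁ : E3 → ℝ) : Prop :=
  Tendsto (radialDeriv fun x => ‖x‖ * u₀ x) (cocompact E3) (𝓝 0) ∧
    Tendsto (fun x : E3 => ‖x‖ * u₁ x) (cocompact E3) (𝓝 0)

/-- The forward sign condition: spherical means of `∂ₜ v` about some point are eventually positive
along some outgoing characteristic `t = r - q`. -/
def ForwardSign (v : ℝ → E3 → ℝ) : Prop :=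
  ∃ x₀ : E3, ∃ q : ℝ, 0 ≤ q ∧ ∃ r₀ : ℝ, q ≤ r₀ ∧
    ∀ r : ℝ, r₀ ≤ r → 0 < sphericalMean x₀ (timeDeriv v (r - q)) r

/-- The backward sign condition: spherical means of `∂ₜ v` about some point are eventually negative
along some characteristic `t = -(r - q)`. -/
def BackwardSign (v : ℝ → E3 → ℝ) : Prop :=
  ∃ x₀ : E3, ∃ q : ℝ, 0 ≤ q ∧ ∃ r₀ : ℝ, q ≤ r₀ ∧
    ∀ r : ℝ, r₀ ≤ r → sphericalMean x₀ (timeDeriv v (-(r - q))) r < 0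

/-- `∂ₜ u → +∞` in finite positive time, for solutions with data `(u₀, u₁)`. There are a time
`Tstar` and a radius `R`, depending only on the data, such that for solutions on the cylinders
`[0, T) × {|x| < R}`:
no solution exists beyond the time `Tstar`; as long as a solution exists, `∂ₜ u (t, ·)` reaches a
value `b t`, where `b` depends only on the data and `b t → +∞` as `t → Tstar`; and a solution that
exists up to the time `Tstar` has `∂ₜ u` unbounded above near some point `(Tstar, y)`. -/
def BlowsUpForward (u₀ u₁ : E3 → ℝ) : Prop :=
  ∃ Tstar : ℝ, 0 < Tstar ∧ ∃ R : ℝ, 0 < R ∧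
    ∃ b : ℝ → ℝ, Tendsto b (𝓝[<] Tstar) atTop ∧
      (∀ (T : ℝ) (u : ℝ → E3 → ℝ), 0 < T → IsJohnSolution (Ico 0 T) (ball 0 R) u₀ u₁ u →
        T ≤ Tstar ∧ ∀ t ∈ Ioo 0 T, ∃ x ∈ ball (0 : E3) R, b t ≤ timeDeriv u t x) ∧
      ∀ u : ℝ → E3 → ℝ, IsJohnSolution (Ico 0 Tstar) (ball 0 R) u₀ u₁ u →
        ∃ y ∈ ball (0 : E3) R, ∀ C : ℝ,
          ∃ᶠ p : ℝ × E3 in 𝓝[<] Tstar ×ˢ 𝓝 y, C < timeDeriv u p.1 p.2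

/-- `∂ₜ u → -∞` in finite negative time, for solutions with data `(u₀, u₁)`: the same for
solutions on the cylinders `(-T, 0] × {|x| < R}`. -/
def BlowsUpBackward (u₀ u₁ : E3 → ℝ) : Prop :=
  ∃ Tstar : ℝ, 0 < Tstar ∧ ∃ R : ℝ, 0 < R ∧
    ∃ b : ℝ → ℝ, Tendsto b (𝓝[>] (-Tstar)) atBot ∧
      (∀ (T : ℝ) (u : ℝ → E3 → ℝ), 0 < T → IsJohnSolution (Ioc (-T) 0) (ball 0 R) u₀ u₁ u →
        T ≤ Tstar ∧ ∀ t ∈ Ioo (-T) 0, ∃ x ∈ ball (0 : E3) R, timeDeriv u t x ≤ b t) ∧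
      ∀ u : ℝ → E3 → ℝ, IsJohnSolution (Ioc (-Tstar) 0) (ball 0 R) u₀ u₁ u →
        ∃ y ∈ ball (0 : E3) R, ∀ C : ℝ,
          ∃ᶠ p : ℝ × E3 in 𝓝[>] (-Tstar) ×ˢ 𝓝 y, timeDeriv u p.1 p.2 < C

end

/-!
The argument takes place on the outgoing characteristic `r = t + q` of the sign condition, with `r
= |x - x₀|`. Write `M` for spherical means about `x₀`. The difference `w = u - ulin` has zero data
and solves `∂ₜ² w - Δ w = (∂ₜ u)²`, so `r M[w]` solves the wave equation on the half line with
source `r M[(∂ₜ u)²] ≥ 0`. Since `q ≥ 0`, the backward light cone of a point of the characteristic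
does not see the reflection at `r = 0`. Hence `r M[∂ₜ w]` is half the integral of the source over
the outgoing characteristic plus half its integral over the incoming one, and the latter is
nonnegative (`mean_lower_bound`). With Jensen's inequality, `m (t) = M[∂ₜ u (t)](t + q)` satisfies

  `(t + q) m (t) ≥ (t + q) M[∂ₜ ulin (t)](t + q) + ½ ∫₀ᵗ (s + q) m (s)² ds`

(`IsJohnSolution.exists_riccati_mean`). The free term is positive from some time on; one unit of
time later the integral exceeds a constant `δ > 0` that depends only on the free wave, and
comparison with `y' = y² / (2 (t + q))` forces blow-up in finite time (`riccati_lower_bound`). The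
backward statement follows by time reversal, which preserves the equation because `(∂ₜ u)²` is
even.

Solutions are only `C¹` and the equation holds in the sense of distributions. The reduction to one
space dimension therefore happens on the side of the test functions: for `φ = α (t + r) β (t - r)
/ r` one has `∂ₜ² φ - Δ φ = 4 α' (t + r) β' (t - r) / r` (`waveOp_nullTest`). Taking for `α`, `β`
smooth approximations of indicator functions gives the integrated equation on characteristic
rectangles (`rectangle_identity`), and two thin rectangles along the two characteristics through a
point, with the initial line as their other end, yield the bound on the time derivative.
-/

/-! ### Polar coordinates and radial functions -/

/-- Integration in polar coordinates about `x₀`. -/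
theorem integral_eq_polar (x₀ : E3) {f : E3 → ℝ} (hf : Integrable f) :
    ∫ x, f x = ∫ r in Ioi (0 : ℝ), r ^ 2 *
      ∫ ξ : sphere (0 : E3) 1, f (x₀ + r • (ξ : E3)) ∂((volume : Measure E3).toSphere) := by
  set g : E3 → ℝ := fun x => f (x₀ + x) with hg
  have hgi : Integrable g := hf.comp_add_left x₀
  have hdim : Module.finrank ℝ E3 = 3 := by simp
  have hmp := (volume : Measure E3).measurePreserving_homeomorphUnitSphereProd
  have hemb := (homeomorphUnitSphereProd E3).measurableEmbedding
  rw [hdim] at hmp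
  set G : sphere (0 : E3) 1 × Ioi (0 : ℝ) → ℝ := fun p => g ((p.2 : ℝ) • (p.1 : E3)) with hG
  have hcomp : G ∘ homeomorphUnitSphereProd E3 = fun x : ({0}ᶜ : Set E3) => g x := by
    funext x
    have : ‖(x : E3)‖ ≠ 0 := norm_ne_zero_iff.2 x.2
    simp [hG, smul_smul, this]
  have hGi : Integrable G
      ((volume : Measure E3).toSphere.prod (Measure.volumeIoiPow (3 - 1))) := by
    rw [← hmp.integrable_comp_emb hemb, hcomp]
    have := integrableOn_iff_comap_subtypeVal (μ := (volume : Measure E3)) (f := g)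
      (measurableSet_singleton (0 : E3)).compl
    exact this.1 hgi.integrableOn
  calc ∫ x, f x = ∫ x, g x := (integral_add_left_eq_self f x₀).symm
    _ = ∫ x : ({(0)}ᶜ : Set E3), g x ∂((volume : Measure E3).comap (↑)) := by
      rw [integral_subtype_comap (measurableSet_singleton _).compl g, restrict_compl_singleton]
    _ = ∫ p, G p ∂((volume : Measure E3).toSphere.prod (Measure.volumeIoiPow (3 - 1))) := by
      rw [← hmp.integral_comp hemb G]
      exact integral_congr_ae (.of_forall fun x => (congrFun hcomp x).symm)
    _ = ∫ r : Ioi (0 : ℝ), (∫ ξ, G (ξ, r) ∂((volume : Measure E3).toSphere))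
          ∂(Measure.volumeIoiPow (3 - 1)) := integral_prod_symm G hGi
    _ = _ := by
      simp only [Measure.volumeIoiPow, ENNReal.ofReal]
      rw [integral_withDensity_eq_integral_smul,
        integral_subtype_comap measurableSet_Ioi fun a : ℝ => Real.toNNReal (a ^ (3 - 1)) •
          ∫ ξ : sphere (0 : E3) 1, g (a • (ξ : E3)) ∂((volume : Measure E3).toSphere)]
      · refine setIntegral_congr_fun measurableSet_Ioi fun r hr => ?_
        simp only [hg]
        rw [NNReal.smul_def, Real.coe_toNNReal _ (pow_nonneg hr.out.le _), smul_eq_mul]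
      · exact (measurable_subtype_coe.pow_const _).real_toNNReal

theorem hasFDerivAt_norm_sub {x₀ y : E3} (hy : y ≠ x₀) :
    HasFDerivAt (fun y => ‖y - x₀‖) (‖y - x₀‖⁻¹ • innerSL ℝ (y - x₀)) y := by
  have h1 : HasFDerivAt (fun y : E3 => y - x₀) (ContinuousLinearMap.id ℝ E3) y :=
    (hasFDerivAt_id y).sub_const x₀
  have h0 : ‖y - x₀‖ ≠ 0 := norm_ne_zero_iff.2 (sub_ne_zero.2 hy)
  have h2 := (h1.norm_sq).sqrt (by positivity)
  refine (h2.congr_fderiv ?_).congr_of_eventuallyEq ?_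
  · ext v
    simp [Real.sqrt_sq (norm_nonneg _)]
    field_simp
  · exact .of_forall fun z => (Real.sqrt_sq (norm_nonneg _)).symm

/-- The Laplacian of a radial function: `Δ (K(r)) = K'' + 2 K' / r`. -/
theorem laplacian_radial {K K' K'' : ℝ → ℝ} (hK : ∀ r, 0 < r → HasDerivAt K (K' r) r)
    (hK' : ∀ r, 0 < r → HasDerivAt K' (K'' r) r) {x₀ x : E3} (hx : x ≠ x₀) :
    Laplacian.laplacian (fun y : E3 => K ‖y - x₀‖) x =
      K'' ‖x - x₀‖ + 2 * K' ‖x - x₀‖ / ‖x - x₀‖ := by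
  -- the inner product as a real bilinear form
  obtain ⟨B, hB⟩ : ∃ B : E3 →L[ℝ] E3 →L[ℝ] ℝ, ∀ v, innerSL ℝ v = B v :=
    ⟨innerSL ℝ, fun _ => rfl⟩
  have hpos : ∀ {y : E3}, y ≠ x₀ → 0 < ‖y - x₀‖ := fun h => norm_pos_iff.2 (sub_ne_zero.2 h)
  have h1 : ∀ y : E3, y ≠ x₀ → HasFDerivAt (fun y : E3 => K ‖y - x₀‖)
      ((K' ‖y - x₀‖ * ‖y - x₀‖⁻¹) • B (y - x₀)) y := fun y hy => by
    have := (hK _ (hpos hy)).comp_hasFDerivAt y (hasFDerivAt_norm_sub hy)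
    rwa [smul_smul, hB] at this
  have hev : fderiv ℝ (fun y : E3 => K ‖y - x₀‖) =ᶠ[𝓝 x]
      fun y => (K' ‖y - x₀‖ * ‖y - x₀‖⁻¹) • B (y - x₀) := by
    filter_upwards [isOpen_ne.mem_nhds hx] with y hy using (h1 y hy).fderiv
  set ρ := ‖x - x₀‖ with hρ
  have hρ0 : 0 < ρ := hpos hx
  have hc : HasFDerivAt (fun y : E3 => K' ‖y - x₀‖ * ‖y - x₀‖⁻¹)
      ((K'' ρ * ρ⁻¹ - K' ρ * (ρ ^ 2)⁻¹) • (ρ⁻¹ • B (x - x₀))) x := by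
    have hd : HasDerivAt (fun r => K' r * r⁻¹) (K'' ρ * ρ⁻¹ - K' ρ * (ρ ^ 2)⁻¹) ρ := by
      refine ((hK' ρ hρ0).mul (hasDerivAt_inv hρ0.ne')).congr_deriv ?_
      ring
    rw [← hB]
    exact hd.comp_hasFDerivAt x (hasFDerivAt_norm_sub hx)
  have hL : HasFDerivAt (fun y : E3 => B (y - x₀)) B x :=
    B.hasFDerivAt.comp x ((hasFDerivAt_id x).sub_const x₀)
  have h2 : fderiv ℝ (fderiv ℝ (fun y : E3 => K ‖y - x₀‖)) x =
      (K' ρ * ρ⁻¹) • B +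
      ((K'' ρ * ρ⁻¹ - K' ρ * (ρ ^ 2)⁻¹) • (ρ⁻¹ • B (x - x₀))).smulRight
        (B (x - x₀)) := by
    rw [hev.fderiv_eq]
    exact (hc.smul hL).fderiv
  rw [InnerProductSpace.laplacian_eq_iteratedFDeriv_stdOrthonormalBasis]
  set e := stdOrthonormalBasis ℝ E3
  have hsum : ∑ i, inner ℝ (x - x₀) (e i) ^ 2 = ρ ^ 2 := by
    rw [hρ]; exact e.sum_sq_inner_left (x - x₀)
  have hone : ∀ i, inner ℝ (e i) (e i) = (1 : ℝ) := fun i => by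
    rw [real_inner_self_eq_norm_sq, e.norm_eq_one]; norm_num
  have hBe : ∀ v w, B v w = inner ℝ v w := fun v w => by rw [← hB]; rfl
  have hterm : ∀ i, iteratedFDeriv ℝ 2 (fun y : E3 => K ‖y - x₀‖) x ![e i, e i] =
      K' ρ * ρ⁻¹ + (K'' ρ * ρ⁻¹ - K' ρ * (ρ ^ 2)⁻¹) * ρ⁻¹ * inner ℝ (x - x₀) (e i) ^ 2 := by
    intro i
    rw [iteratedFDeriv_two_apply, h2]
    simp only [Matrix.cons_val_zero, Matrix.cons_val_one, add_apply,
      smul_apply, ContinuousLinearMap.smulRight_apply, hBe,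
      smul_eq_mul, hone]
    ring
  simp only [hterm, Finset.sum_add_distrib, ← Finset.mul_sum, hsum]
  simp only [Finset.sum_const, Finset.card_univ, Fintype.card_fin, finrank_euclideanSpace_fin,
    nsmul_eq_mul]
  field_simp
  push_cast
  ring

/-! ### Spherical means -/

theorem sphere_measureReal_univ :
    ((volume : Measure E3).toSphere).real univ = 4 * Real.pi := by
  rw [Measure.toSphere_real_apply_univ, measureReal_def, EuclideanSpace.volume_ball_fin_three]
  have : (0 : ℝ) ≤ Real.pi * 4 / 3 := by positivity
  simp
  rw [ENNReal.toReal_ofReal this]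
  ring

theorem integral_eq_polar_mean (x₀ : E3) {f : E3 → ℝ} (hf : Integrable f) :
    ∫ x, f x = 4 * Real.pi * ∫ r in Ioi (0 : ℝ), r ^ 2 * sphericalMean x₀ f r := by
  rw [integral_eq_polar x₀ hf, ← integral_const_mul]
  refine integral_congr_ae (.of_forall fun r => ?_)
  simp only [sphericalMean]
  have := Real.pi_pos.ne'
  field_simp

theorem continuous_sphericalMean {X : Type*} [TopologicalSpace X] [FirstCountableTopology X]
    [LocallyCompactSpace X] {g : X → E3 → ℝ} (hg : Continuous fun p : X × E3 => g p.1 p.2)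
    (x₀ : E3) : Continuous fun p : X × ℝ => sphericalMean x₀ (g p.1) p.2 := by
  unfold sphericalMean
  refine continuous_const.mul ?_
  have := continuous_parametric_integral_of_continuous
    (μ := (volume : Measure E3).toSphere) (s := univ)
    (f := fun (p : X × ℝ) (ξ : sphere (0 : E3) 1) => g p.1 (x₀ + p.2 • (ξ : E3)))
    (by
      have : Continuous fun z : (X × ℝ) × sphere (0 : E3) 1 =>
        (z.1.1, x₀ + z.1.2 • (z.2 : E3)) := by fun_prop
      exact hg.comp this) isCompact_univ
  simpa using this

/-! ### Test functions in null coordinates -/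

/-- The spherically symmetric test function `α (s + r) β (s - r) / r`, `r = |x - x₀|`. It is used
only with `α`, `β` for which it vanishes near `r = 0`, so that the quotient there is harmless. -/
noncomputable def nullTest (α β : ℝ → ℝ) (x₀ : E3) (s : ℝ) (x : E3) : ℝ :=
  α (s + ‖x - x₀‖) * β (s - ‖x - x₀‖) / ‖x - x₀‖

section
variable {α β : ℝ → ℝ} {a₁ a₂ b₁ b₂ : ℝ}

theorem nullTest_eq_zero (hα : ∀ x ∉ Icc a₁ a₂, α x = 0) (hβ : ∀ x ∉ Icc b₁ b₂, β x = 0)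
    {x₀ : E3} {s : ℝ} {x : E3}
    (h : ¬ (s + ‖x - x₀‖ ∈ Icc a₁ a₂ ∧ s - ‖x - x₀‖ ∈ Icc b₁ b₂)) :
    nullTest α β x₀ s x = 0 := by
  rw [not_and_or] at h
  rcases h with h | h
  · simp [nullTest, hα _ h]
  · simp [nullTest, hβ _ h]

theorem isCompact_nullBox (x₀ : E3) (a₁ a₂ b₁ b₂ : ℝ) :
    IsCompact {p : ℝ × E3 | p.1 + ‖p.2 - x₀‖ ∈ Icc a₁ a₂ ∧ p.1 - ‖p.2 - x₀‖ ∈ Icc b₁ b₂} := by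
  refine IsCompact.of_isClosed_subset
    ((isCompact_Icc (a := (a₁ + b₁) / 2) (b := (a₂ + b₂) / 2)).prod
      (isCompact_closedBall x₀ ((a₂ - b₁) / 2))) ?_ ?_
  · exact (isClosed_Icc.preimage (by fun_prop)).inter (isClosed_Icc.preimage (by fun_prop))
  · rintro ⟨s, x⟩ ⟨⟨h1, h2⟩, h3, h4⟩
    simp only at h1 h2 h3 h4
    refine ⟨⟨by simp only; linarith, by simp only; linarith⟩, ?_⟩
    rw [mem_closedBall, dist_eq_norm]
    simp only; linarith

theorem tsupport_nullTest_subset (hα : ∀ x ∉ Icc a₁ a₂, α x = 0)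
    (hβ : ∀ x ∉ Icc b₁ b₂, β x = 0) (x₀ : E3) :
    tsupport (fun p : ℝ × E3 => nullTest α β x₀ p.1 p.2) ⊆
      {p : ℝ × E3 | p.1 + ‖p.2 - x₀‖ ∈ Icc a₁ a₂ ∧ p.1 - ‖p.2 - x₀‖ ∈ Icc b₁ b₂} := by
  refine closure_minimal (fun p hp => ?_) (isCompact_nullBox x₀ a₁ a₂ b₁ b₂).isClosed
  by_contra h
  exact hp (nullTest_eq_zero hα hβ h)

theorem hasCompactSupport_nullTest (hα : ∀ x ∉ Icc a₁ a₂, α x = 0)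
    (hβ : ∀ x ∉ Icc b₁ b₂, β x = 0) (x₀ : E3) :
    HasCompactSupport (fun p : ℝ × E3 => nullTest α β x₀ p.1 p.2) :=
  (isCompact_nullBox x₀ a₁ a₂ b₁ b₂).of_isClosed_subset (isClosed_tsupport _)
    (tsupport_nullTest_subset hα hβ x₀)

theorem contDiff_nullTest (hα : ∀ x ∉ Icc a₁ a₂, α x = 0) (hβ : ∀ x ∉ Icc b₁ b₂, β x = 0)
    (hab : b₂ < a₁) (hαs : ContDiff ℝ ∞ α) (hβs : ContDiff ℝ ∞ β) (x₀ : E3) :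
    ContDiff ℝ ∞ (fun p : ℝ × E3 => nullTest α β x₀ p.1 p.2) := by
  rw [contDiff_iff_contDiffAt]
  rintro ⟨s, x⟩
  by_cases hx : x = x₀
  · subst hx
    -- near the axis `r = 0` the function vanishes identically
    refine (contDiffAt_const (c := (0 : ℝ))).congr_of_eventuallyEq ?_
    have : ∀ᶠ p : ℝ × E3 in 𝓝 (s, x), ‖p.2 - x‖ < (a₁ - b₂) / 2 := by
      refine (Continuous.tendsto (by fun_prop) (s, x)).eventually_lt_const ?_
      simp only [sub_self, norm_zero]; linarith
    filter_upwards [this] with p hp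
    refine nullTest_eq_zero hα hβ ?_
    rintro ⟨h1, h2⟩
    linarith [h1.1, h2.2]
  · have hn : ContDiffAt ℝ ∞ (fun p : ℝ × E3 => ‖p.2 - x₀‖) (s, x) :=
      (contDiffAt_snd.sub contDiffAt_const).norm ℝ (sub_ne_zero.2 hx)
    unfold nullTest
    refine ((hαs.contDiffAt.comp _ (contDiffAt_fst.add hn)).mul
      (hβs.contDiffAt.comp _ (contDiffAt_fst.sub hn))).div hn ?_
    exact norm_ne_zero_iff.2 (sub_ne_zero.2 hx)

theorem iteratedDeriv_two_eq {f f' f'' : ℝ → ℝ} (h : ∀ r, HasDerivAt f (f' r) r)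
    (h' : ∀ r, HasDerivAt f' (f'' r) r) (r : ℝ) : iteratedDeriv 2 f r = f'' r := by
  rw [iteratedDeriv_succ, iteratedDeriv_one, funext fun r => (h r).deriv, (h' r).deriv]

theorem waveOp_nullTest (hαs : ContDiff ℝ ∞ α) (hβs : ContDiff ℝ ∞ β) {x₀ x : E3}
    (hx : x ≠ x₀) (s : ℝ) :
    waveOp (nullTest α β x₀) s x =
      4 * nullTest (deriv α) (deriv β) x₀ s x := by
  have hd : ∀ {f : ℝ → ℝ}, ContDiff ℝ ∞ f → ContDiff ℝ ∞ (deriv f) := fun hf =>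
    ((contDiff_infty_iff_deriv).1 hf).2
  have hD : ∀ {f : ℝ → ℝ}, ContDiff ℝ ∞ f → ∀ x, HasDerivAt f (deriv f x) x := fun hf x =>
    (hf.differentiable (by simp) x).hasDerivAt
  have a1 := hD hαs
  have a2 := hD (hd hαs)
  have b1 := hD hβs
  have b2 := hD (hd hβs)
  set ρ := ‖x - x₀‖ with hρ
  have hρ0 : 0 < ρ := norm_pos_iff.2 (sub_ne_zero.2 hx)
  set α' := deriv α
  set β' := deriv β
  set α'' := deriv α'
  set β'' := deriv β'
  have ht : iteratedDeriv 2 (fun s => nullTest α β x₀ s x) s =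
      (α'' (s + ρ) * β (s - ρ) + 2 * α' (s + ρ) * β' (s - ρ) + α (s + ρ) * β'' (s - ρ)) / ρ := by
    refine iteratedDeriv_two_eq (f' := fun s => (α' (s + ρ) * β (s - ρ) +
      α (s + ρ) * β' (s - ρ)) / ρ) (f'' := fun s => (α'' (s + ρ) * β (s - ρ) +
      2 * α' (s + ρ) * β' (s - ρ) + α (s + ρ) * β'' (s - ρ)) / ρ) ?_ ?_ s
    · intro s
      exact (((a1 (s + ρ)).comp_add_const s ρ).mul ((b1 (s - ρ)).comp_sub_const s ρ)).div_const ρ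
    · intro s
      refine ((((a2 (s + ρ)).comp_add_const s ρ).mul ((b1 (s - ρ)).comp_sub_const s ρ)).add
        (((a1 (s + ρ)).comp_add_const s ρ).mul
          ((b2 (s - ρ)).comp_sub_const s ρ))).div_const ρ |>.congr_deriv ?_
      ring
  have hr : Laplacian.laplacian (fun y => nullTest α β x₀ s y) x =
      (α'' (s + ρ) * β (s - ρ) - 2 * α' (s + ρ) * β' (s - ρ) + α (s + ρ) * β'' (s - ρ)) / ρ := by
    have c1 : ∀ r, HasDerivAt (fun r => α (s + r) * β (s - r))
        (α' (s + r) * β (s - r) - α (s + r) * β' (s - r)) r := fun r => by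
      refine (((a1 (s + r)).comp_const_add s r).mul
        ((b1 (s - r)).comp_const_sub s r)).congr_deriv ?_
      ring
    have c2 : ∀ r, HasDerivAt (fun r => α' (s + r) * β (s - r) - α (s + r) * β' (s - r))
        (α'' (s + r) * β (s - r) - 2 * α' (s + r) * β' (s - r) + α (s + r) * β'' (s - r)) r :=
      fun r => by
      refine ((((a2 (s + r)).comp_const_add s r).mul ((b1 (s - r)).comp_const_sub s r)).sub
        (((a1 (s + r)).comp_const_add s r).mul
          ((b2 (s - r)).comp_const_sub s r))).congr_deriv ?_
      ring
    set k := fun r => α (s + r) * β (s - r)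
    set k' := fun r => α' (s + r) * β (s - r) - α (s + r) * β' (s - r)
    set k'' := fun r =>
      α'' (s + r) * β (s - r) - 2 * α' (s + r) * β' (s - r) + α (s + r) * β'' (s - r)
    have c1' : ∀ r, HasDerivAt k (k' r) r := c1
    have c2' : ∀ r, HasDerivAt k' (k'' r) r := c2
    have := laplacian_radial (K := fun r => k r / r) (K' := fun r => k' r / r - k r / r ^ 2)
      (K'' := fun r => k'' r / r - 2 * k' r / r ^ 2 + 2 * k r / r ^ 3)
      (fun r hr => ((c1' r).div (hasDerivAt_id r) hr.ne').congr_deriv (by simp; field_simp))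
      (fun r hr => (((c2' r).div (hasDerivAt_id r) hr.ne').sub
        ((c1' r).div (hasDerivAt_pow 2 r) (by positivity))).congr_deriv
          (by simp; field_simp; ring)) hx
    refine this.trans ?_
    simp only [← hρ]
    field_simp
    ring
  unfold waveOp
  rw [ht]
  erw [hr]
  simp only [nullTest, ← hρ]
  ring

/-- Integration against a test function in null coordinates, in terms of spherical means. -/
theorem integral_mul_nullTest {g : ℝ → E3 → ℝ} (hg : Continuous fun p : ℝ × E3 => g p.1 p.2)
    (hα : ∀ x ∉ Icc a₁ a₂, α x = 0) (hβ : ∀ x ∉ Icc b₁ b₂, β x = 0) (hab : b₂ < a₁)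
    (hαc : Continuous α) (hβc : Continuous β) (x₀ : E3) :
    ∫ p : ℝ × E3, g p.1 p.2 * nullTest α β x₀ p.1 p.2 =
      4 * Real.pi * ∫ s : ℝ, ∫ r : ℝ, r * sphericalMean x₀ (g s) r * (α (s + r) * β (s - r)) := by
  set c := (a₁ - b₂) / 2 with hc
  have hc0 : 0 < c := by rw [hc]; linarith
  have hcont : Continuous fun p : ℝ × E3 => nullTest α β x₀ p.1 p.2 := by
    -- on the support `r ≥ c`, so that `1 / r` may be replaced by `1 / max r c`
    have : (fun p : ℝ × E3 => nullTest α β x₀ p.1 p.2) = fun p : ℝ × E3 =>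
        α (p.1 + ‖p.2 - x₀‖) * β (p.1 - ‖p.2 - x₀‖) / max ‖p.2 - x₀‖ c := by
      funext p
      by_cases h : p.1 + ‖p.2 - x₀‖ ∈ Icc a₁ a₂ ∧ p.1 - ‖p.2 - x₀‖ ∈ Icc b₁ b₂
      · have : c ≤ ‖p.2 - x₀‖ := by linarith [h.1.1, h.2.2]
        simp [nullTest, max_eq_left this]
      · rw [nullTest_eq_zero hα hβ h]
        rw [not_and_or] at h
        rcases h with h | h
        · simp [hα _ h]
        · simp [hβ _ h]
    rw [this]
    refine Continuous.div (by fun_prop) (by fun_prop) fun p => ?_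
    exact (lt_of_lt_of_le hc0 (le_max_right _ _)).ne'
  have hI : Continuous fun p : ℝ × E3 => g p.1 p.2 * nullTest α β x₀ p.1 p.2 := hg.mul hcont
  have hsupp : HasCompactSupport fun p : ℝ × E3 => g p.1 p.2 * nullTest α β x₀ p.1 p.2 :=
    (hasCompactSupport_nullTest hα hβ x₀).mul_left
  have hslice : ∀ s, Integrable fun x => g s x * nullTest α β x₀ s x := by
    intro s
    refine Continuous.integrable_of_hasCompactSupport
      (hI.comp (by fun_prop : Continuous fun x : E3 => (s, x))) ?_
    refine HasCompactSupport.intro (isCompact_closedBall x₀ (s - b₁)) fun x hx => ?_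
    rw [mem_closedBall, dist_eq_norm] at hx
    rw [nullTest_eq_zero hα hβ (fun h => hx (by linarith [h.2.1])), mul_zero]
  rw [Measure.volume_eq_prod, integral_prod _ (hI.integrable_of_hasCompactSupport hsupp),
    ← integral_const_mul]
  refine integral_congr_ae (.of_forall fun s => ?_)
  simp only
  rw [integral_eq_polar_mean x₀ (hslice s), ← setIntegral_eq_integral_of_forall_compl_eq_zero
    (s := Ioi (0 : ℝ))
    (f := fun r => r * sphericalMean x₀ (g s) r * (α (s + r) * β (s - r)))]
  · congr 1
    refine setIntegral_congr_fun measurableSet_Ioi fun r (hr : 0 < r) => ?_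
    have hn : ∀ ξ : sphere (0 : E3) 1, nullTest α β x₀ s (x₀ + r • (ξ : E3)) =
        α (s + r) * β (s - r) / r := fun ξ => by
      have : ‖r • (ξ : E3)‖ = r := by simp [norm_smul, abs_of_pos hr]
      simp [nullTest, this]
    simp only [sphericalMean, hn]
    rw [integral_mul_const]
    field_simp
  · intro r hr
    have hr' : r ≤ 0 := not_lt.1 hr
    by_cases h1 : s + r ∈ Icc a₁ a₂
    · have h2 : s - r ∉ Icc b₁ b₂ := fun h => by linarith [h.2, h1.1]
      simp [hβ _ h2]
    · simp [hα _ h1]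

/-- Change to the null coordinates `ξ = s + r`, `η = s - r`. -/
theorem integral_null_coords {Φ : ℝ → ℝ → ℝ} (hΦ : Continuous fun p : ℝ × ℝ => Φ p.1 p.2)
    (h0 : ∀ ξ η, ¬ (ξ ∈ Icc a₁ a₂ ∧ η ∈ Icc b₁ b₂) → Φ ξ η = 0) :
    ∫ s : ℝ, ∫ r : ℝ, Φ (s + r) (s - r) = 2⁻¹ * ∫ ξ : ℝ, ∫ η : ℝ, Φ ξ η := by
  have h1 : ∀ s : ℝ, ∫ r : ℝ, Φ (s + r) (s - r) = ∫ ξ : ℝ, Φ ξ (2 * s - ξ) := fun s => by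
    rw [← integral_add_left_eq_self (fun ξ => Φ ξ (2 * s - ξ)) s]
    refine integral_congr_ae (.of_forall fun r => ?_)
    simp only
    congr 1; ring
  have h2 : ∀ ξ : ℝ, ∫ s : ℝ, Φ ξ (2 * s - ξ) = 2⁻¹ * ∫ η : ℝ, Φ ξ η := fun ξ => by
    rw [Measure.integral_comp_mul_left (fun y => Φ ξ (y - ξ)) 2,
      integral_sub_right_eq_self (fun η => Φ ξ η) ξ]
    simp
  simp_rw [h1]
  rw [integral_integral_swap, ← integral_const_mul]
  · exact integral_congr_ae (.of_forall h2)
  · refine Continuous.integrable_of_hasCompactSupport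
      (hΦ.comp (by fun_prop : Continuous fun p : ℝ × ℝ => (p.2, 2 * p.1 - p.2))) ?_
    refine HasCompactSupport.intro ((isCompact_Icc (a := (a₁ + b₁) / 2) (b := (a₂ + b₂) / 2)).prod
      (isCompact_Icc (a := a₁) (b := a₂))) fun p hp => h0 _ _ fun h => hp ⟨?_, h.1⟩
    exact ⟨by linarith [h.1.1, h.2.1], by linarith [h.1.2, h.2.2]⟩

end

/-! ### The distributional equation tested on smoothed rectangles -/

/-- For smooth `α`, `β` the wave equation tested on `nullTest α β x₀` is the equation
`4 ∂_ξ ∂_η W = F` for `W = r M[w]`, `F = r M[f]`, tested on `α (ξ) β (η)`. -/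
theorem weak_equation_null_coords {w f : ℝ → E3 → ℝ} {α β : ℝ → ℝ} {a₁ a₂ b₁ b₂ : ℝ} {x₀ : E3}
    (hw : Continuous fun p : ℝ × E3 => w p.1 p.2) (hf : Continuous fun p : ℝ × E3 => f p.1 p.2)
    (hα : ∀ x ∉ Icc a₁ a₂, α x = 0) (hβ : ∀ x ∉ Icc b₁ b₂, β x = 0) (hab : b₂ < a₁)
    (hαs : ContDiff ℝ ∞ α) (hβs : ContDiff ℝ ∞ β)
    (heq : ∫ p : ℝ × E3, w p.1 p.2 * waveOp (nullTest α β x₀) p.1 p.2 =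
      ∫ p : ℝ × E3, f p.1 p.2 * nullTest α β x₀ p.1 p.2) :
    4 * ∫ ξ : ℝ, ∫ η : ℝ, ((ξ - η) / 2 * sphericalMean x₀ (w ((ξ + η) / 2)) ((ξ - η) / 2)) *
        (deriv α ξ * deriv β η) =
      ∫ ξ : ℝ, ∫ η : ℝ, ((ξ - η) / 2 * sphericalMean x₀ (f ((ξ + η) / 2)) ((ξ - η) / 2)) *
        (α ξ * β η) := by
  have key : ∀ {g : ℝ → E3 → ℝ} {A B : ℝ → ℝ}, (Continuous fun p : ℝ × E3 => g p.1 p.2) →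
      (∀ x ∉ Icc a₁ a₂, A x = 0) → (∀ x ∉ Icc b₁ b₂, B x = 0) → Continuous A → Continuous B →
      ∫ p : ℝ × E3, g p.1 p.2 * nullTest A B x₀ p.1 p.2 = 4 * Real.pi * (2⁻¹ *
      ∫ ξ : ℝ, ∫ η : ℝ, ((ξ - η) / 2 * sphericalMean x₀ (g ((ξ + η) / 2)) ((ξ - η) / 2)) *
        (A ξ * B η)) := by
    intro g A B hg hA hB hAc hBc
    rw [integral_mul_nullTest hg hA hB hab hAc hBc x₀, ← integral_null_coords (a₁ := a₁) (a₂ := a₂)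
      (b₁ := b₁) (b₂ := b₂)]
    · congr 1
      refine integral_congr_ae (.of_forall fun s => integral_congr_ae (.of_forall fun r => ?_))
      simp only
      rw [show (s + r - (s - r)) / 2 = r by ring, show (s + r + (s - r)) / 2 = s by ring]
    · have h1 := (continuous_sphericalMean hg x₀).comp
        (by fun_prop : Continuous fun p : ℝ × ℝ => ((p.1 + p.2) / 2, (p.1 - p.2) / 2))
      exact ((by fun_prop : Continuous fun p : ℝ × ℝ => (p.1 - p.2) / 2).mul h1).mul (by fun_prop)
    · intro ξ η h
      rw [not_and_or] at h
      rcases h with h | h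
      · simp [hA _ h]
      · simp [hB _ h]
  have hsupp : ∀ {γ : ℝ → ℝ} {c d : ℝ}, (∀ x ∉ Icc c d, γ x = 0) →
      ∀ x ∉ Icc c d, deriv γ x = 0 := by
    intro γ c d h x hx
    have : γ =ᶠ[𝓝 x] fun _ => 0 := by
      filter_upwards [isClosed_Icc.isOpen_compl.mem_nhds hx] with y hy using h y hy
    rw [this.deriv_eq]; simp
  have hne : ∀ᵐ p : ℝ × E3, p.2 ≠ x₀ := by
    have : (volume : Measure (ℝ × E3)) (univ ×ˢ {x₀}) = 0 := by
      rw [Measure.volume_eq_prod, Measure.prod_prod]; simp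
    rw [ae_iff]
    refine measure_mono_null (fun p hp => ?_) this
    simpa using hp
  have hL : ∫ p : ℝ × E3, w p.1 p.2 * waveOp (nullTest α β x₀) p.1 p.2 =
      4 * ∫ p : ℝ × E3, w p.1 p.2 * nullTest (deriv α) (deriv β) x₀ p.1 p.2 := by
    rw [← integral_const_mul]
    refine integral_congr_ae ?_
    filter_upwards [hne] with p hp
    rw [waveOp_nullTest hαs hβs hp]
    ring
  rw [hL, key hw (hsupp hα) (hsupp hβ) (hαs.continuous_deriv (by simp))
    (hβs.continuous_deriv (by simp)), key hf hα hβ hαs.continuous hβs.continuous] at heq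
  have hpi := Real.pi_pos.ne'
  have : Real.pi * 2 ≠ 0 := by positivity
  apply mul_left_cancel₀ this
  linarith

/-- A smooth approximation of the indicator function of `[a, b]` as `ε → 0`. -/
noncomputable def smoothIndicator (ε a b x : ℝ) : ℝ :=
  Real.smoothTransition ((x - a) / ε) - Real.smoothTransition ((x - b) / ε)

/-- The average of `h` over `[a, a + ε]` with the weight `smoothTransition'`; it is `h a` for
`ε = 0`. -/
noncomputable def bumpAverage (h : ℝ → ℝ) (ε a : ℝ) : ℝ :=
  ∫ x in (0 : ℝ)..1, h (a + ε * x) * deriv Real.smoothTransition x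

theorem continuous_deriv_smoothTransition : Continuous (deriv Real.smoothTransition) :=
  (Real.smoothTransition.contDiff (n := ⊤)).continuous_deriv (by simp)

theorem hasDerivAt_smoothTransition (x : ℝ) :
    HasDerivAt Real.smoothTransition (deriv Real.smoothTransition x) x :=
  ((Real.smoothTransition.contDiff (n := ⊤)).differentiable (by simp) x).hasDerivAt

theorem integral_deriv_smoothTransition :
    ∫ x in (0 : ℝ)..1, deriv Real.smoothTransition x = 1 := by
  rw [intervalIntegral.integral_eq_sub_of_hasDerivAt
    (fun x _ => hasDerivAt_smoothTransition x)
    (continuous_deriv_smoothTransition.intervalIntegrable _ _)]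
  simp

theorem deriv_smoothTransition_eq_zero {x : ℝ} (hx : x ∉ Icc (0 : ℝ) 1) :
    deriv Real.smoothTransition x = 0 := by
  rw [mem_Icc, not_and_or, not_le, not_le] at hx
  rcases hx with hx | hx
  · have : Real.smoothTransition =ᶠ[𝓝 x] fun _ => 0 := by
      filter_upwards [Iio_mem_nhds hx] with y hy
      exact Real.smoothTransition.zero_of_nonpos (le_of_lt hy)
    rw [this.deriv_eq]; simp
  · have : Real.smoothTransition =ᶠ[𝓝 x] fun _ => 1 := by
      filter_upwards [Ioi_mem_nhds hx] with y hy
      exact Real.smoothTransition.one_of_one_le (le_of_lt hy)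
    rw [this.deriv_eq]; simp

theorem contDiff_smoothIndicator (ε a b : ℝ) : ContDiff ℝ ∞ (smoothIndicator ε a b) := by
  unfold smoothIndicator
  exact ((Real.smoothTransition.contDiff (n := ⊤)).comp (by fun_prop)).sub
    ((Real.smoothTransition.contDiff (n := ⊤)).comp (by fun_prop))

theorem smoothIndicator_eq_zero {ε a b : ℝ} (hε : 0 < ε) (hab : a ≤ b) {x : ℝ}
    (hx : x ∉ Icc a (b + ε)) : smoothIndicator ε a b x = 0 := by
  rw [mem_Icc, not_and_or, not_le, not_le] at hx
  unfold smoothIndicator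
  rcases hx with hx | hx
  · rw [Real.smoothTransition.zero_of_nonpos, Real.smoothTransition.zero_of_nonpos, sub_zero]
    · exact div_nonpos_of_nonpos_of_nonneg (by linarith) hε.le
    · exact div_nonpos_of_nonpos_of_nonneg (by linarith) hε.le
  · rw [Real.smoothTransition.one_of_one_le, Real.smoothTransition.one_of_one_le, sub_self]
    · rw [le_div_iff₀ hε]; linarith
    · rw [le_div_iff₀ hε]; linarith

theorem hasDerivAt_smoothIndicator (ε a b x : ℝ) :
    HasDerivAt (smoothIndicator ε a b) (ε⁻¹ * deriv Real.smoothTransition ((x - a) / ε) -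
      ε⁻¹ * deriv Real.smoothTransition ((x - b) / ε)) x := by
  have h : ∀ c, HasDerivAt (fun x => Real.smoothTransition ((x - c) / ε))
      (ε⁻¹ * deriv Real.smoothTransition ((x - c) / ε)) x := fun c => by
    have h1 : HasDerivAt (fun x => (x - c) / ε) ε⁻¹ x := by
      simpa using ((hasDerivAt_id x).sub_const c).div_const ε
    exact ((hasDerivAt_smoothTransition _).comp x h1).congr_deriv (mul_comm _ _)
  exact (h a).sub (h b)

theorem bumpAverage_zero (h : ℝ → ℝ) (a : ℝ) : bumpAverage h 0 a = h a := by
  simp [bumpAverage, integral_deriv_smoothTransition]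

theorem continuous_bumpAverage {X : Type*} [TopologicalSpace X] [FirstCountableTopology X]
    {h : X → ℝ → ℝ} (hh : Continuous fun p : X × ℝ => h p.1 p.2) {e : X → ℝ} (he : Continuous e)
    (a : ℝ) : Continuous fun x => bumpAverage (h x) (e x) a := by
  unfold bumpAverage
  refine intervalIntegral.continuous_parametric_intervalIntegral_of_continuous' ?_ 0 1
  have h1 : Continuous fun p : X × ℝ => h p.1 (a + e p.1 * p.2) :=
    hh.comp (by fun_prop : Continuous fun p : X × ℝ => (p.1, a + e p.1 * p.2))
  exact h1.mul (continuous_deriv_smoothTransition.comp continuous_snd)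

theorem integral_mul_deriv_smoothIndicator {h : ℝ → ℝ} (hh : Continuous h) {ε : ℝ} (hε : 0 < ε)
    (a b : ℝ) : ∫ x, h x * deriv (smoothIndicator ε a b) x =
      bumpAverage h ε a - bumpAverage h ε b := by
  have hbump : ∀ c, Integrable (fun x => h x * (ε⁻¹ * deriv Real.smoothTransition ((x - c) / ε))) ∧
      ∫ x, h x * (ε⁻¹ * deriv Real.smoothTransition ((x - c) / ε)) = bumpAverage h ε c := by
    intro c
    have hcont : Continuous fun x => h x * (ε⁻¹ * deriv Real.smoothTransition ((x - c) / ε)) :=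
      hh.mul (continuous_const.mul (continuous_deriv_smoothTransition.comp (by fun_prop)))
    refine ⟨hcont.integrable_of_hasCompactSupport
      (HasCompactSupport.intro (isCompact_Icc (a := c) (b := c + ε)) fun x hx => ?_), ?_⟩
    · rw [deriv_smoothTransition_eq_zero fun h => hx ?_]
      · simp
      · have h1 := h.1; have h2 := h.2
        rw [le_div_iff₀ hε] at h1; rw [div_le_iff₀ hε] at h2
        exact ⟨by linarith, by linarith⟩
    · have h1 := integral_add_left_eq_self (μ := (volume : Measure ℝ))
        (fun x => h x * (ε⁻¹ * deriv Real.smoothTransition ((x - c) / ε))) c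
      have h2 := Measure.integral_comp_mul_left
        (fun x => h (c + x) * (ε⁻¹ * deriv Real.smoothTransition ((c + x - c) / ε))) ε
      rw [h1, abs_of_pos (inv_pos.2 hε), smul_eq_mul] at h2
      have h3 : ∫ x, h (c + ε * x) * (ε⁻¹ * deriv Real.smoothTransition ((c + ε * x - c) / ε)) =
          ε⁻¹ * bumpAverage h ε c := by
        have : ∀ x, h (c + ε * x) * (ε⁻¹ * deriv Real.smoothTransition ((c + ε * x - c) / ε)) =
            ε⁻¹ * (h (c + ε * x) * deriv Real.smoothTransition x) := fun x => by
          rw [show (c + ε * x - c) / ε = x by field_simp; ring]; ring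
        simp_rw [this]
        rw [integral_const_mul, bumpAverage, intervalIntegral.integral_of_le zero_le_one,
          ← integral_Icc_eq_integral_Ioc, setIntegral_eq_integral_of_forall_compl_eq_zero]
        intro x hx
        rw [deriv_smoothTransition_eq_zero hx, mul_zero]
      rw [h3] at h2
      exact (mul_left_cancel₀ (inv_pos.2 hε).ne' h2).symm
  rw [← (hbump a).2, ← (hbump b).2, ← integral_sub (hbump a).1 (hbump b).1]
  refine integral_congr_ae (.of_forall fun x => ?_)
  simp only [(hasDerivAt_smoothIndicator ε a b x).deriv]
  ring

theorem integral_mul_smoothIndicator {h : ℝ → ℝ} (hh : Continuous h) {ε : ℝ} (hε : 0 < ε)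
    {a b : ℝ} (hab : a ≤ b) : ∫ x, h x * smoothIndicator ε a b x =
      bumpAverage (fun x => ∫ y in (0 : ℝ)..x, h y) ε b -
        bumpAverage (fun x => ∫ y in (0 : ℝ)..x, h y) ε a := by
  have hH : ∀ x, HasDerivAt (fun x => ∫ y in (0 : ℝ)..x, h y) (h x) x := fun x =>
    (intervalIntegral.integral_hasDerivAt_right (hh.intervalIntegrable _ _)
      hh.aestronglyMeasurable.stronglyMeasurableAtFilter hh.continuousAt)
  have hHc : Continuous fun x => ∫ y in (0 : ℝ)..x, h y :=
    continuous_iff_continuousAt.2 fun x => (hH x).continuousAt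
  have hs := contDiff_smoothIndicator ε a b
  have hcs : HasCompactSupport (smoothIndicator ε a b) :=
    HasCompactSupport.intro isCompact_Icc fun x hx => smoothIndicator_eq_zero hε hab hx
  have := integral_mul_deriv_eq_deriv_mul_of_integrable (v := smoothIndicator ε a b)
    (fun x _ => hH x) (fun x _ => (hs.differentiable (by simp) x).hasDerivAt)
    ((hHc.mul (hs.continuous_deriv (by simp))).integrable_of_hasCompactSupport hcs.deriv.mul_left)
    ((hh.mul hs.continuous).integrable_of_hasCompactSupport hcs.mul_left)
    ((hHc.mul hs.continuous).integrable_of_hasCompactSupport hcs.mul_left)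
  rw [integral_mul_deriv_smoothIndicator hHc hε] at this
  linarith

/-- A continuous `W` that solves `4 ∂_ξ ∂_η W = F` in the sense of distributions near the rectangle
`[a₁, a₂] × [b₁, b₂]`, with `F` continuous, satisfies the integrated equation on it. -/
theorem rectangle_identity {W F : ℝ → ℝ → ℝ} (hW : Continuous fun p : ℝ × ℝ => W p.1 p.2)
    (hF : Continuous fun p : ℝ × ℝ => F p.1 p.2) {a₁ a₂ b₁ b₂ ε₀ : ℝ} (ha : a₁ ≤ a₂) (hb : b₁ ≤ b₂)
    (hε₀ : 0 < ε₀)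
    (heq : ∀ α β : ℝ → ℝ, ContDiff ℝ ∞ α → ContDiff ℝ ∞ β →
      (∀ x ∉ Icc a₁ (a₂ + ε₀), α x = 0) → (∀ x ∉ Icc b₁ (b₂ + ε₀), β x = 0) →
      4 * ∫ ξ : ℝ, ∫ η : ℝ, W ξ η * (deriv α ξ * deriv β η) =
        ∫ ξ : ℝ, ∫ η : ℝ, F ξ η * (α ξ * β η)) :
    4 * (W a₂ b₂ - W a₂ b₁ - (W a₁ b₂ - W a₁ b₁)) = ∫ ξ in a₁..a₂, ∫ η in b₁..b₂, F ξ η := by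
  -- the two sides of `heq` for smoothed indicator functions, as continuous functions of `ε`
  set k : ℝ → ℝ → ℝ := fun ε ξ => bumpAverage (W ξ) ε b₁ - bumpAverage (W ξ) ε b₂ with hk
  set F₁ : ℝ → ℝ → ℝ := fun ξ η => ∫ y in (0 : ℝ)..η, F ξ y with hF₁
  set m : ℝ → ℝ → ℝ := fun ε ξ => bumpAverage (F₁ ξ) ε b₂ - bumpAverage (F₁ ξ) ε b₁ with hm
  set M : ℝ → ℝ → ℝ := fun ε ξ => ∫ x in (0 : ℝ)..ξ, m ε x with hM
  have hkc : Continuous fun p : ℝ × ℝ => k p.1 p.2 := by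
    have : Continuous fun q : (ℝ × ℝ) × ℝ => W q.1.2 q.2 :=
      hW.comp (by fun_prop : Continuous fun q : (ℝ × ℝ) × ℝ => (q.1.2, q.2))
    exact (continuous_bumpAverage (h := fun p : ℝ × ℝ => W p.2) this continuous_fst b₁).sub
      (continuous_bumpAverage (h := fun p : ℝ × ℝ => W p.2) this continuous_fst b₂)
  have hF₁c : Continuous fun p : ℝ × ℝ => F₁ p.1 p.2 :=
    intervalIntegral.continuous_parametric_primitive_of_continuous (f := F) hF
  have hmc : Continuous fun p : ℝ × ℝ => m p.1 p.2 := by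
    have : Continuous fun q : (ℝ × ℝ) × ℝ => F₁ q.1.2 q.2 :=
      hF₁c.comp (by fun_prop : Continuous fun q : (ℝ × ℝ) × ℝ => (q.1.2, q.2))
    exact (continuous_bumpAverage (h := fun p : ℝ × ℝ => F₁ p.2) this continuous_fst b₂).sub
      (continuous_bumpAverage (h := fun p : ℝ × ℝ => F₁ p.2) this continuous_fst b₁)
  have hMc : Continuous fun p : ℝ × ℝ => M p.1 p.2 :=
    intervalIntegral.continuous_parametric_primitive_of_continuous (f := m) hmc
  have hLc : Continuous fun ε => 4 * (bumpAverage (k ε) ε a₁ - bumpAverage (k ε) ε a₂) :=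
    continuous_const.mul ((continuous_bumpAverage hkc continuous_id a₁).sub
      (continuous_bumpAverage hkc continuous_id a₂))
  have hRc : Continuous fun ε => bumpAverage (M ε) ε a₂ - bumpAverage (M ε) ε a₁ :=
    (continuous_bumpAverage hMc continuous_id a₂).sub
      (continuous_bumpAverage hMc continuous_id a₁)
  have hW1 : ∀ ξ, Continuous (W ξ) := fun ξ =>
    hW.comp (by fun_prop : Continuous fun y : ℝ => (ξ, y))
  have hF1 : ∀ ξ, Continuous (F ξ) := fun ξ =>
    hF.comp (by fun_prop : Continuous fun y : ℝ => (ξ, y))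
  have hEq : ∀ ε ∈ Ioo 0 ε₀, 4 * (bumpAverage (k ε) ε a₁ - bumpAverage (k ε) ε a₂) =
      bumpAverage (M ε) ε a₂ - bumpAverage (M ε) ε a₁ := by
    rintro ε ⟨h0, h1⟩
    have hsub : ∀ c d : ℝ, Icc c (d + ε) ⊆ Icc c (d + ε₀) := fun c d =>
      Icc_subset_Icc_right (by linarith)
    have := heq (smoothIndicator ε a₁ a₂) (smoothIndicator ε b₁ b₂)
      (contDiff_smoothIndicator _ _ _) (contDiff_smoothIndicator _ _ _)
      (fun x hx => smoothIndicator_eq_zero h0 ha fun h => hx (hsub _ _ h))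
      (fun x hx => smoothIndicator_eq_zero h0 hb fun h => hx (hsub _ _ h))
    have e1 : ∀ ξ, ∫ η : ℝ, W ξ η * (deriv (smoothIndicator ε a₁ a₂) ξ *
        deriv (smoothIndicator ε b₁ b₂) η) = k ε ξ * deriv (smoothIndicator ε a₁ a₂) ξ := by
      intro ξ
      rw [hk]
      simp only
      rw [← integral_mul_deriv_smoothIndicator (hW1 ξ) h0, ← integral_mul_const]
      exact integral_congr_ae (.of_forall fun η => by simp only; ring)
    have e2 : ∀ ξ, ∫ η : ℝ, F ξ η * (smoothIndicator ε a₁ a₂ ξ *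
        smoothIndicator ε b₁ b₂ η) = m ε ξ * smoothIndicator ε a₁ a₂ ξ := by
      intro ξ
      rw [hm]
      simp only
      rw [hF₁, ← integral_mul_smoothIndicator (hF1 ξ) h0 hb, ← integral_mul_const]
      exact integral_congr_ae (.of_forall fun η => by simp only; ring)
    simp_rw [e1, e2] at this
    rwa [integral_mul_deriv_smoothIndicator
      (h := k ε) (hkc.comp (by fun_prop : Continuous fun y : ℝ => (ε, y))) h0,
      integral_mul_smoothIndicator
      (h := m ε) (hmc.comp (by fun_prop : Continuous fun y : ℝ => (ε, y))) h0 ha] at this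
  have hlim := tendsto_nhds_unique_of_eventuallyEq
    ((hLc.tendsto 0).mono_left nhdsWithin_le_nhds)
    ((hRc.tendsto 0).mono_left (nhdsWithin_le_nhds (s := Ioi 0)))
    (by filter_upwards [Ioo_mem_nhdsGT hε₀] with ε hε using hEq ε hε)
  simp only [bumpAverage_zero, hk, hM, hm] at hlim
  have hm0 : ∀ ξ, F₁ ξ b₂ - F₁ ξ b₁ = ∫ η in b₁..b₂, F ξ η := fun ξ => by
    rw [hF₁]
    exact intervalIntegral.integral_interval_sub_left ((hF1 ξ).intervalIntegrable _ _)
      ((hF1 ξ).intervalIntegrable _ _)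
  have hc0 : Continuous fun ξ => F₁ ξ b₂ - F₁ ξ b₁ :=
    (hF₁c.comp (by fun_prop : Continuous fun y : ℝ => (y, b₂))).sub
      (hF₁c.comp (by fun_prop : Continuous fun y : ℝ => (y, b₁)))
  rw [intervalIntegral.integral_interval_sub_left (hc0.intervalIntegrable _ _)
    (hc0.intervalIntegrable _ _)] at hlim
  simp_rw [hm0] at hlim
  rw [← hlim]
  ring

/-! ### The lower bound along an outgoing characteristic -/

theorem sphericalMean_nonneg {f : E3 → ℝ} (hf : ∀ x, 0 ≤ f x) (x₀ : E3) (r : ℝ) :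
    0 ≤ sphericalMean x₀ f r := by
  unfold sphericalMean
  have := Real.pi_pos
  exact mul_nonneg (by positivity) (integral_nonneg fun ξ => hf _)

theorem sphericalMean_zero_of_ball {f : E3 → ℝ} {x₀ : E3} {ρ r : ℝ}
    (hf : ∀ x ∈ ball x₀ ρ, f x = 0) (hr : 0 ≤ r) (hr' : r < ρ) : sphericalMean x₀ f r = 0 := by
  have : ∀ ξ : sphere (0 : E3) 1, f (x₀ + r • (ξ : E3)) = 0 := fun ξ => hf _ (by
    simpa [mem_ball, dist_eq_norm, norm_smul, abs_of_nonneg hr] using hr')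
  simp [sphericalMean, this]

theorem sphericalMean_intervalIntegral {p : ℝ → E3 → ℝ}
    (hp : Continuous fun z : ℝ × E3 => p z.1 z.2) (x₀ : E3) (s r : ℝ) :
    sphericalMean x₀ (fun x => ∫ τ in (0 : ℝ)..s, p τ x) r =
      ∫ τ in (0 : ℝ)..s, sphericalMean x₀ (p τ) r := by
  unfold sphericalMean
  rw [intervalIntegral.integral_const_mul]
  congr 1
  have hc : Continuous fun z : ℝ × sphere (0 : E3) 1 => p z.1 (x₀ + r • (z.2 : E3)) :=
    hp.comp (by fun_prop : Continuous fun z : ℝ × sphere (0 : E3) 1 =>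
      (z.1, x₀ + r • (z.2 : E3)))
  have := intervalIntegral_integral_swap (a := 0) (b := s) (μ := (volume : Measure E3).toSphere)
    (f := fun (τ : ℝ) (ξ : sphere (0 : E3) 1) => p τ (x₀ + r • (ξ : E3))) (by
      have h2 : IntegrableOn (Function.uncurry
          fun (τ : ℝ) (ξ : sphere (0 : E3) 1) => p τ (x₀ + r • (ξ : E3)))
          (uIoc 0 s ×ˢ univ) (volume.prod (volume : Measure E3).toSphere) :=
        (hc.continuousOn.integrableOn_compact (isCompact_uIcc.prod isCompact_univ)).mono_set
          (prod_mono uIoc_subset_uIcc Subset.rfl)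
      rwa [IntegrableOn, ← Measure.prod_restrict, Measure.restrict_univ] at h2)
  exact this.symm

/-- Let `w (s) = ∫₀ˢ p`, which has zero data, solve `∂ₛ² w - Δ w = f ≥ 0` in the sense of
distributions. On the outgoing characteristic `r = t + q`, `q ≥ 0`, the function `r M[∂ₜ w]` is at
least half the integral of the source `r M[f]` over this characteristic; the contribution of the
incoming characteristic through the same point is nonnegative. -/
theorem mean_lower_bound {p f : ℝ → E3 → ℝ} (hp : Continuous fun z : ℝ × E3 => p z.1 z.2)
    (hf : Continuous fun z : ℝ × E3 => f z.1 z.2) (hf0 : ∀ s x, 0 ≤ f s x) {x₀ : E3} {T ρ : ℝ}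
    (hp0 : ∀ x ∈ ball x₀ ρ, p 0 x = 0)
    (heq : ∀ φ : ℝ → E3 → ℝ, ContDiff ℝ ∞ (fun z : ℝ × E3 => φ z.1 z.2) →
      HasCompactSupport (fun z : ℝ × E3 => φ z.1 z.2) →
      tsupport (fun z : ℝ × E3 => φ z.1 z.2) ⊆ Ioo 0 T ×ˢ ball x₀ ρ →
      ∫ z : ℝ × E3, (∫ τ in (0 : ℝ)..z.1, p τ z.2) * waveOp φ z.1 z.2 =
        ∫ z : ℝ × E3, f z.1 z.2 * φ z.1 z.2)
    {q t : ℝ} (hq : 0 ≤ q) (ht : 0 < t) (htT : t < T) (htρ : 2 * t + q < ρ) :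
    2⁻¹ * ∫ s in (0 : ℝ)..t, (s + q) * sphericalMean x₀ (f s) (s + q) ≤
      (t + q) * sphericalMean x₀ (p t) (t + q) := by
  set w : ℝ → E3 → ℝ := fun s x => ∫ τ in (0 : ℝ)..s, p τ x with hw
  have hwc : Continuous fun z : ℝ × E3 => w z.1 z.2 := by
    have := intervalIntegral.continuous_parametric_primitive_of_continuous (μ := volume) (a₀ := 0)
      (f := fun (x : E3) (τ : ℝ) => p τ x)
      (hp.comp (by fun_prop : Continuous fun z : E3 × ℝ => (z.2, z.1)))
    exact this.comp (by fun_prop : Continuous fun z : ℝ × E3 => (z.2, z.1))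
  set V : ℝ → ℝ → ℝ := fun s r => r * sphericalMean x₀ (p s) r with hV
  have hVc : Continuous fun z : ℝ × ℝ => V z.1 z.2 :=
    continuous_snd.mul (continuous_sphericalMean hp x₀)
  set D : ℝ → ℝ → ℝ := fun s r => r * sphericalMean x₀ (w s) r with hD
  have hDc : Continuous fun z : ℝ × ℝ => D z.1 z.2 :=
    continuous_snd.mul (continuous_sphericalMean hwc x₀)
  have hDV : ∀ s r, D s r = ∫ τ in (0 : ℝ)..s, V τ r := fun s r => by
    simp only [hD, hV, hw]
    rw [sphericalMean_intervalIntegral hp, intervalIntegral.integral_const_mul]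
  -- `D = s E` with `E` continuous and `E = 0` at `s = 0`: near the initial line `D` is `o(s)`
  set E : ℝ → ℝ → ℝ := fun s r => ∫ x in (0 : ℝ)..1, V (s * x) r with hE
  have hEc : Continuous fun z : ℝ × ℝ => E z.1 z.2 :=
    intervalIntegral.continuous_parametric_intervalIntegral_of_continuous'
      (f := fun (z : ℝ × ℝ) x => V (z.1 * x) z.2)
      (hVc.comp (by fun_prop : Continuous fun z : (ℝ × ℝ) × ℝ => (z.1.1 * z.2, z.1.2))) 0 1
  have hDE : ∀ s r, D s r = s * E s r := fun s r => by
    rw [hDV, hE]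
    simp only
    rw [intervalIntegral.mul_integral_comp_mul_left (f := fun τ => V τ r)]
    simp
  have hE0 : ∀ r, 0 ≤ r → r < ρ → E 0 r = 0 := fun r h1 h2 => by
    simp [hE, hV, sphericalMean_zero_of_ball hp0 h1 h2]
  -- source and solution in null coordinates
  set F : ℝ → ℝ → ℝ := fun ξ η =>
    (ξ - η) / 2 * sphericalMean x₀ (f ((ξ + η) / 2)) ((ξ - η) / 2) with hF
  have hFc : Continuous fun z : ℝ × ℝ => F z.1 z.2 :=
    (continuous_snd.mul (continuous_sphericalMean hf x₀)).comp
      (by fun_prop : Continuous fun z : ℝ × ℝ => ((z.1 + z.2) / 2, (z.1 - z.2) / 2))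
  have hFnn : ∀ ξ η, η ≤ ξ → 0 ≤ F ξ η := fun ξ η h =>
    mul_nonneg (by linarith) (sphericalMean_nonneg (hf0 _) _ _)
  have hrect : ∀ a₁ a₂ b₁ b₂ : ℝ, a₁ ≤ a₂ → b₁ ≤ b₂ → 0 < a₁ + b₁ → b₂ < a₁ → a₂ + b₂ < 2 * T →
      a₂ - b₁ < 2 * ρ → 4 * (D ((a₂ + b₂) / 2) ((a₂ - b₂) / 2) - D ((a₂ + b₁) / 2) ((a₂ - b₁) / 2) -
        (D ((a₁ + b₂) / 2) ((a₁ - b₂) / 2) - D ((a₁ + b₁) / 2) ((a₁ - b₁) / 2))) =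
        ∫ ξ in a₁..a₂, ∫ η in b₁..b₂, F ξ η := by
    intro a₁ a₂ b₁ b₂ ha hb h1 h2 h3 h4
    obtain ⟨ε, hε0, hε⟩ : ∃ ε : ℝ, 0 < ε ∧ ε < min (a₁ - b₂)
        (min ((2 * T - (a₂ + b₂)) / 2) (2 * ρ - (a₂ - b₁))) :=
      exists_between (lt_min (by linarith) (lt_min (by linarith) (by linarith)))
    rw [lt_min_iff, lt_min_iff] at hε
    obtain ⟨e1, e2, e3⟩ := hε
    refine rectangle_identity (W := fun ξ η => D ((ξ + η) / 2) ((ξ - η) / 2))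
      (hDc.comp (by fun_prop : Continuous fun z : ℝ × ℝ => ((z.1 + z.2) / 2, (z.1 - z.2) / 2)))
      hFc ha hb hε0 ?_
    intro α β hα hβ hα0 hβ0
    refine weak_equation_null_coords hwc hf hα0 hβ0 (by linarith) hα hβ (heq _ ?_ ?_ ?_)
    · exact contDiff_nullTest hα0 hβ0 (by linarith) hα hβ x₀
    · exact hasCompactSupport_nullTest hα0 hβ0 x₀
    · refine (tsupport_nullTest_subset hα0 hβ0 x₀).trans ?_
      rintro ⟨s, x⟩ ⟨⟨c1, c2⟩, c3, c4⟩
      simp only at c1 c2 c3 c4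
      refine ⟨⟨by simp only; linarith, by simp only; linarith⟩, ?_⟩
      rw [mem_ball, dist_eq_norm]
      simp only; linarith
  -- the two sides of the inequality at scale `h`, divided by `h`
  set L : ℝ → ℝ := fun h => 4 * ∫ x in (-1 : ℝ)..1, V (t + h * x) (t + q) with hL
  have hLc : Continuous L := continuous_const.mul
    (intervalIntegral.continuous_parametric_intervalIntegral_of_continuous'
      (f := fun h x => V (t + h * x) (t + q))
      (hVc.comp (by fun_prop : Continuous fun z : ℝ × ℝ => (t + z.1 * z.2, t + q))) _ _)
  set N : ℝ → ℝ → ℝ := fun h ξ => ∫ y in (-1 : ℝ)..1, F ξ (-q + h * y) with hN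
  have hNc : Continuous fun z : ℝ × ℝ => N z.1 z.2 :=
    intervalIntegral.continuous_parametric_intervalIntegral_of_continuous'
      (f := fun (z : ℝ × ℝ) y => F z.2 (-q + z.1 * y))
      (hFc.comp (by fun_prop : Continuous fun z : (ℝ × ℝ) × ℝ => (z.1.2, -q + z.1.1 * z.2))) _ _
  set A : ℝ → ℝ := fun h => (∫ ξ in q..(2 * t + q + h), N h ξ) - ∫ ξ in q..(q + 2 * h), N h ξ
    with hA
  have hAc : Continuous A :=
    (intervalIntegral.continuous_parametric_intervalIntegral_of_continuous (f := N) hNc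
      (by fun_prop)).sub
    (intervalIntegral.continuous_parametric_intervalIntegral_of_continuous (f := N) hNc
      (by fun_prop))
  set B : ℝ → ℝ := fun h => 4 * (3 / 2 * E (3 * h / 2) (q + h / 2) -
    1 / 2 * E (h / 2) (q + 3 * h / 2) + 3 / 2 * E (3 * h / 2) (2 * t + q - h / 2) -
    1 / 2 * E (h / 2) (2 * t + q - 3 * h / 2)) with hB
  have hBc : Continuous B := by
    have hc : ∀ {a b : ℝ → ℝ}, Continuous a → Continuous b → Continuous fun h => E (a h) (b h) :=
      fun ha hb => hEc.comp (ha.prodMk hb)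
    have h1 := hc (a := fun h => 3 * h / 2) (b := fun h => q + h / 2) (by fun_prop) (by fun_prop)
    have h2 := hc (a := fun h => h / 2) (b := fun h => q + 3 * h / 2) (by fun_prop) (by fun_prop)
    have h3 := hc (a := fun h => 3 * h / 2) (b := fun h => 2 * t + q - h / 2)
      (by fun_prop) (by fun_prop)
    have h4 := hc (a := fun h => h / 2) (b := fun h => 2 * t + q - 3 * h / 2)
      (by fun_prop) (by fun_prop)
    simp only [hB]
    fun_prop
  have hineq : ∀ h, 0 < h → h < t / 2 → h < T - t → h < ρ - (2 * t + q) → A h + B h ≤ L h := by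
    intro h h0 h1 h2 h3
    -- a rectangle along the outgoing and one along the incoming characteristic
    have r1 := hrect (q + 2 * h) (2 * t + q + h) (-q - h) (-q + h) (by linarith) (by linarith)
      (by linarith) (by linarith) (by linarith) (by linarith)
    have r2 := hrect (2 * t + q - h) (2 * t + q + h) (-(2 * t + q) + 2 * h) (-q - h) (by linarith)
      (by linarith) (by linarith) (by linarith) (by linarith) (by linarith)
    have r2nn : 0 ≤ ∫ ξ in (2 * t + q - h)..(2 * t + q + h),
        ∫ η in (-(2 * t + q) + 2 * h)..(-q - h), F ξ η := by
      refine intervalIntegral.integral_nonneg (by linarith) fun ξ hξ => ?_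
      refine intervalIntegral.integral_nonneg (by linarith) fun η hη => hFnn _ _ ?_
      linarith [hξ.1, hη.2]
    have r1A : ∫ ξ in (q + 2 * h)..(2 * t + q + h), ∫ η in (-q - h)..(-q + h), F ξ η =
        h * A h := by
      have : ∀ ξ, ∫ η in (-q - h)..(-q + h), F ξ η = h * N h ξ := fun ξ => by
        simp only [hN]
        rw [intervalIntegral.mul_integral_comp_add_mul (f := fun η => F ξ η)]
        congr 1 <;> ring
      simp_rw [this]
      have hNh : Continuous (N h) := hNc.comp (by fun_prop : Continuous fun y : ℝ => (h, y))
      rw [intervalIntegral.integral_const_mul, hA]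
      simp only
      rw [intervalIntegral.integral_interval_sub_left (hNh.intervalIntegrable _ _)
        (hNh.intervalIntegrable _ _)]
    have rL : 4 * (D (t + h) (t + q) - D (t - h) (t + q)) = h * L h := by
      have hVr : Continuous fun s => V s (t + q) :=
        hVc.comp (by fun_prop : Continuous fun y : ℝ => (y, t + q))
      simp only [hDV, hL]
      rw [intervalIntegral.integral_interval_sub_left (hVr.intervalIntegrable _ _)
        (hVr.intervalIntegrable _ _), mul_left_comm,
        intervalIntegral.mul_integral_comp_add_mul (f := fun s => V s (t + q))]
      congr 2 <;> ring
    rw [r1A] at r1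
    rw [← r2] at r2nn
    rw [show (2 * t + q + h + (-q + h)) / 2 = t + h by ring,
      show (2 * t + q + h - (-q + h)) / 2 = t + q by ring,
      show (2 * t + q + h + (-q - h)) / 2 = t by ring,
      show (2 * t + q + h - (-q - h)) / 2 = t + q + h by ring,
      show (q + 2 * h + (-q + h)) / 2 = 3 * h / 2 by ring,
      show (q + 2 * h - (-q + h)) / 2 = q + h / 2 by ring,
      show (q + 2 * h + (-q - h)) / 2 = h / 2 by ring,
      show (q + 2 * h - (-q - h)) / 2 = q + 3 * h / 2 by ring] at r1
    rw [show (2 * t + q + h + (-q - h)) / 2 = t by ring,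
      show (2 * t + q + h - (-q - h)) / 2 = t + q + h by ring,
      show (2 * t + q + h + (-(2 * t + q) + 2 * h)) / 2 = 3 * h / 2 by ring,
      show (2 * t + q + h - (-(2 * t + q) + 2 * h)) / 2 = 2 * t + q - h / 2 by ring,
      show (2 * t + q - h + (-q - h)) / 2 = t - h by ring,
      show (2 * t + q - h - (-q - h)) / 2 = t + q by ring,
      show (2 * t + q - h + (-(2 * t + q) + 2 * h)) / 2 = h / 2 by ring,
      show (2 * t + q - h - (-(2 * t + q) + 2 * h)) / 2 = 2 * t + q - 3 * h / 2 by ring] at r2nn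
    have hBh : h * B h = 4 * (D (3 * h / 2) (q + h / 2) - D (h / 2) (q + 3 * h / 2) +
        D (3 * h / 2) (2 * t + q - h / 2) - D (h / 2) (2 * t + q - 3 * h / 2)) := by
      simp only [hDE, hB]; ring
    refine le_of_mul_le_mul_left ?_ h0
    rw [mul_add, ← rL, ← r1, hBh]
    linarith
  have hlim : A 0 + B 0 ≤ L 0 := by
    refine le_of_tendsto_of_tendsto (b := 𝓝[>] (0 : ℝ))
      (((hAc.add hBc).tendsto 0).mono_left nhdsWithin_le_nhds)
      ((hLc.tendsto 0).mono_left nhdsWithin_le_nhds) ?_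
    have hm : 0 < min (t / 2) (min (T - t) (ρ - (2 * t + q))) :=
      lt_min (by linarith) (lt_min (by linarith) (by linarith))
    filter_upwards [Ioo_mem_nhdsGT hm] with h hh
    have := hh.2
    rw [lt_min_iff, lt_min_iff] at this
    exact hineq h hh.1 this.1 this.2.1 this.2.2
  have hB0 : B 0 = 0 := by
    simp [hB, hE0 q hq (by linarith), hE0 (2 * t + q) (by linarith) htρ]
  have hL0 : L 0 = 8 * V t (t + q) := by
    simp [hL]; ring
  have hA0 : A 0 = 4 * ∫ s in (0 : ℝ)..t, (s + q) * sphericalMean x₀ (f s) (s + q) := by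
    have h1 : ∀ ξ, N 0 ξ = 2 * F ξ (-q) := fun ξ => by
      simp only [hN, zero_mul, add_zero, intervalIntegral.integral_const, smul_eq_mul]; ring
    have h2 := intervalIntegral.mul_integral_comp_add_mul (a := 0) (b := t)
      (f := fun ξ => F ξ (-q)) 2 q
    have h3 : ∀ s, F (q + 2 * s) (-q) = (s + q) * sphericalMean x₀ (f s) (s + q) := fun s => by
      simp only [hF]
      rw [show (q + 2 * s - -q) / 2 = s + q by ring, show (q + 2 * s + -q) / 2 = s by ring]
    simp_rw [h3] at h2
    simp only [hA, h1, intervalIntegral.integral_const_mul, add_zero, mul_zero,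
      intervalIntegral.integral_same, sub_zero]
    rw [show 2 * t + q = q + 2 * t by ring]
    rw [mul_zero, add_zero] at h2
    linarith
  rw [hB0, hL0, hA0] at hlim
  simp only [hV] at hlim
  linarith

/-! ### The Riccati inequality for spherical means of solutions -/

theorem integrable_sphere {f : E3 → ℝ} (hf : Continuous f) (x₀ : E3) (r : ℝ) :
    Integrable (fun ξ : sphere (0 : E3) 1 => f (x₀ + r • (ξ : E3)))
      (volume : Measure E3).toSphere := by
  have hc : Continuous fun ξ : sphere (0 : E3) 1 => f (x₀ + r • (ξ : E3)) :=
    hf.comp (by fun_prop)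
  rw [← integrableOn_univ]
  exact hc.continuousOn.integrableOn_compact isCompact_univ

theorem sphericalMean_sub {f g : E3 → ℝ} (hf : Continuous f) (hg : Continuous g) (x₀ : E3)
    (r : ℝ) : sphericalMean x₀ (fun x => f x - g x) r =
      sphericalMean x₀ f r - sphericalMean x₀ g r := by
  unfold sphericalMean
  rw [integral_sub (integrable_sphere hf x₀ r) (integrable_sphere hg x₀ r), mul_sub]

/-- Jensen's inequality for spherical means. -/
theorem sq_sphericalMean_le {f : E3 → ℝ} (hf : Continuous f) (x₀ : E3) (r : ℝ) :
    sphericalMean x₀ f r ^ 2 ≤ sphericalMean x₀ (fun x => f x ^ 2) r := by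
  set c := sphericalMean x₀ f r with hc
  have hpi := Real.pi_pos
  have h1 : ∫ ξ : sphere (0 : E3) 1, f (x₀ + r • (ξ : E3)) ∂((volume : Measure E3).toSphere) =
      4 * Real.pi * c := by
    rw [hc, sphericalMean]; field_simp
  have h2 : 0 ≤ ∫ ξ : sphere (0 : E3) 1, (f (x₀ + r • (ξ : E3)) - c) ^ 2
      ∂((volume : Measure E3).toSphere) := integral_nonneg fun ξ => sq_nonneg _
  have h3 : ∀ y : ℝ, (y - c) ^ 2 = y ^ 2 - 2 * c * y + c ^ 2 := fun y => by ring
  simp_rw [h3] at h2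
  have i2 : Integrable (fun ξ : sphere (0 : E3) 1 => f (x₀ + r • (ξ : E3)) ^ 2)
      (volume : Measure E3).toSphere := integrable_sphere (hf.pow 2) x₀ r
  have i1 := (integrable_sphere hf x₀ r).const_mul (2 * c)
  have i3 : Integrable (fun ξ : sphere (0 : E3) 1 => f (x₀ + r • (ξ : E3)) ^ 2 -
      2 * c * f (x₀ + r • (ξ : E3))) (volume : Measure E3).toSphere := i2.sub i1
  rw [integral_add i3 (integrable_const _), integral_sub i2 i1, integral_const_mul, h1,
    integral_const, sphere_measureReal_univ, smul_eq_mul] at h2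
  unfold sphericalMean
  rw [inv_mul_eq_div, le_div_iff₀ (by positivity)]
  linarith

theorem waveOp_eq_zero_of_notMem_tsupport {φ : ℝ → E3 → ℝ} {z : ℝ × E3}
    (hz : z ∉ tsupport fun z : ℝ × E3 => φ z.1 z.2) : waveOp φ z.1 z.2 = 0 := by
  have h0 : ∀ᶠ y : ℝ × E3 in 𝓝 z, φ y.1 y.2 = 0 := notMem_tsupport_iff_eventuallyEq.1 hz
  have h1 : (fun s => φ s z.2) =ᶠ[𝓝 z.1] fun _ => 0 :=
    ((by fun_prop : Continuous fun s : ℝ => (s, z.2)).tendsto z.1).eventually h0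
  have h2 : φ z.1 =ᶠ[𝓝 z.2] fun _ => 0 :=
    ((by fun_prop : Continuous fun x : E3 => (z.1, x)).tendsto z.2).eventually h0
  unfold waveOp
  rw [h1.iteratedDeriv_eq, (InnerProductSpace.laplacian_congr_nhds h2).eq_of_nhds]
  simp

theorem continuous_waveOp {φ : ℝ → E3 → ℝ} (hφ : ContDiff ℝ ∞ fun z : ℝ × E3 => φ z.1 z.2) :
    Continuous fun z : ℝ × E3 => waveOp φ z.1 z.2 := by
  set Φ : ℝ × E3 → ℝ := fun z => φ z.1 z.2
  have hd : ∀ z, HasFDerivAt Φ (fderiv ℝ Φ z) z := fun z =>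
    (hφ.differentiable (by simp) z).hasFDerivAt
  have hφ' : ContDiff ℝ ∞ (fderiv ℝ Φ) := hφ.fderiv_right (by simp)
  have hd' : ∀ z, HasFDerivAt (fderiv ℝ Φ) (fderiv ℝ (fderiv ℝ Φ) z) z := fun z =>
    (hφ'.differentiable (by simp) z).hasFDerivAt
  have hc : Continuous (fderiv ℝ (fderiv ℝ Φ)) := hφ'.continuous_fderiv (by simp)
  have hs : ∀ (x : E3) (s : ℝ), HasFDerivAt (fun s => (s, x))
      (ContinuousLinearMap.inl ℝ ℝ E3) s := fun x s => hasFDerivAt_prodMk_left s x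
  have hx : ∀ (s : ℝ) (x : E3), HasFDerivAt (fun x => (s, x))
      (ContinuousLinearMap.inr ℝ ℝ E3) x := fun s x => hasFDerivAt_prodMk_right s x
  have ht : ∀ z : ℝ × E3, iteratedDeriv 2 (fun s => φ s z.2) z.1 =
      fderiv ℝ (fderiv ℝ Φ) z (1, 0) (1, 0) := fun z => by
    refine iteratedDeriv_two_eq (f' := fun s => fderiv ℝ Φ (s, z.2) (1, 0))
      (f'' := fun s => fderiv ℝ (fderiv ℝ Φ) (s, z.2) (1, 0) (1, 0)) (fun s => ?_) (fun s => ?_) z.1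
    · have h0 := ((hd (s, z.2)).comp s (hs z.2 s)).hasDerivAt
      have h1 : HasDerivAt (fun s => φ s z.2)
          (((fderiv ℝ Φ (s, z.2)).comp (ContinuousLinearMap.inl ℝ ℝ E3)) 1) s := h0
      simpa using h1
    · have h1 := ((hd' (s, z.2)).comp s (hs z.2 s)).hasDerivAt
      have h2 := h1.clm_apply (hasDerivAt_const s ((1, 0) : ℝ × E3))
      simpa using h2
  have hl : ∀ z : ℝ × E3, Laplacian.laplacian (φ z.1) z.2 =
      ∑ i, fderiv ℝ (fderiv ℝ Φ) z (0, stdOrthonormalBasis ℝ E3 i)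
        (0, stdOrthonormalBasis ℝ E3 i) := fun z => by
    rw [InnerProductSpace.laplacian_eq_iteratedFDeriv_stdOrthonormalBasis]
    refine Finset.sum_congr rfl fun i _ => ?_
    rw [iteratedFDeriv_two_apply]
    have h1 : fderiv ℝ (φ z.1) = fun x => (fderiv ℝ Φ (z.1, x)).comp
        (ContinuousLinearMap.inr ℝ ℝ E3) := funext fun x =>
      ((hd (z.1, x)).comp x (hx z.1 x)).fderiv
    have h2 := ((hd' (z.1, z.2)).comp z.2 (hx z.1 z.2)).clm_comp
      (hasFDerivAt_const (ContinuousLinearMap.inr ℝ ℝ E3) z.2)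
    rw [h1]
    erw [h2.fderiv]
    simp
  simp only [waveOp, ht, hl]
  fun_prop

/-- A solution has a time derivative that is continuous up to the initial time. -/
theorem IsWaveSolution.exists_hasDerivWithinAt {G : ℝ → ℝ} {I : Set ℝ} {Ω : Set E3}
    {u₀ u₁ : E3 → ℝ} {u : ℝ → E3 → ℝ} (h : IsWaveSolution G I Ω u₀ u₁ u) (hI : UniqueDiffOn ℝ I)
    (hΩ : IsOpen Ω) : ∃ Q : ℝ × E3 → ℝ, ContinuousOn Q (I ×ˢ Ω) ∧
      ∀ s ∈ I, ∀ x ∈ Ω, HasDerivWithinAt (fun s => u s x) (Q (s, x)) I s := by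
  refine ⟨fun z => fderivWithin ℝ (fun z : ℝ × E3 => u z.1 z.2) (I ×ˢ Ω) z (1, 0), ?_, ?_⟩
  · exact (h.contDiffOn.continuousOn_fderivWithin (hI.prod hΩ.uniqueDiffOn) le_rfl).clm_apply
      continuousOn_const
  · intro s hs x hx
    have h1 := (h.contDiffOn.differentiableOn one_ne_zero (s, x) ⟨hs, hx⟩).hasFDerivWithinAt
    have h2 : HasFDerivWithinAt (fun s : ℝ => (s, x)) (ContinuousLinearMap.inl ℝ ℝ E3) I s :=
      (hasFDerivAt_prodMk_left s x).hasFDerivWithinAt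
    have hm : MapsTo (fun s : ℝ => (s, x)) I (I ×ˢ Ω) := fun τ hτ => ⟨hτ, hx⟩
    have h0 := (h1.comp s h2 hm).hasDerivWithinAt
    have h3 : HasDerivWithinAt (fun s => u s x)
        (((fderivWithin ℝ (fun z : ℝ × E3 => u z.1 z.2) (I ×ˢ Ω) (s, x)).comp
          (ContinuousLinearMap.inl ℝ ℝ E3)) 1) I s := h0
    simpa using h3

/-- The time derivative of a free wave is continuous, equals the data at time `0`, and recovers the
free wave. -/
theorem IsFreeWave.timeDeriv_spec {u₀ u₁ : E3 → ℝ} {v : ℝ → E3 → ℝ} (h : IsFreeWave u₀ u₁ v) :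
    (Continuous fun z : ℝ × E3 => timeDeriv v z.1 z.2) ∧ (∀ x, timeDeriv v 0 x = u₁ x) ∧
      ∀ s x, v s x = u₀ x + ∫ τ in (0 : ℝ)..s, timeDeriv v τ x := by
  obtain ⟨Q, hQ, hd⟩ := IsWaveSolution.exists_hasDerivWithinAt h uniqueDiffOn_univ isOpen_univ
  have hd' : ∀ s x, HasDerivAt (fun s => v s x) (Q (s, x)) s := fun s x =>
    hasDerivWithinAt_univ.1 (hd s (mem_univ _) x (mem_univ _))
  have hQt : ∀ s x, timeDeriv v s x = Q (s, x) := fun s x => (hd' s x).deriv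
  rw [univ_prod_univ, continuousOn_univ] at hQ
  refine ⟨by simpa only [hQt] using hQ, fun x => ?_, fun s x => ?_⟩
  · exact (hasDerivWithinAt_univ.1 (h.initial_deriv x (mem_univ _))).deriv
  · simp only [hQt]
    rw [intervalIntegral.integral_eq_sub_of_hasDerivAt (fun τ _ => hd' τ x)
      ((hQ.comp (by fun_prop : Continuous fun τ : ℝ => (τ, x))).intervalIntegrable _ _),
      ← h.initial x (mem_univ _)]
    ring

/-- Up to a time `T₁ < T` and on a smaller ball, the time derivative of a solution on a cylinder has
a continuous extension to space-time, which also recovers the solution. -/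
theorem IsJohnSolution.exists_continuous_timeDeriv {u₀ u₁ : E3 → ℝ} {u : ℝ → E3 → ℝ}
    {T T₁ R R₁ : ℝ} (h : IsJohnSolution (Ico 0 T) (ball 0 R) u₀ u₁ u) (h₁ : 0 < T₁) (hT : T₁ < T)
    (hR : R₁ < R) : ∃ P : ℝ → E3 → ℝ, (Continuous fun z : ℝ × E3 => P z.1 z.2) ∧
      (∀ s ∈ Ioc 0 T₁, ∀ x ∈ closedBall 0 R₁, timeDeriv u s x = P s x) ∧
      (∀ x ∈ closedBall 0 R₁, P 0 x = u₁ x) ∧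
      ∀ s ∈ Icc 0 T₁, ∀ x ∈ closedBall 0 R₁, u s x = u₀ x + ∫ τ in (0 : ℝ)..s, P τ x := by
  obtain ⟨Q, hQ, hd⟩ := IsWaveSolution.exists_hasDerivWithinAt h (uniqueDiffOn_Ico 0 T) isOpen_ball
  have hsub : closedBall (0 : E3) R₁ ⊆ ball 0 R := closedBall_subset_ball hR
  have hK : IsClosed (Icc 0 T₁ ×ˢ closedBall (0 : E3) R₁) := isClosed_Icc.prod isClosed_closedBall
  have hQK : ContinuousOn Q (Icc 0 T₁ ×ˢ closedBall (0 : E3) R₁) :=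
    hQ.mono (prod_mono (fun s hs => ⟨hs.1, hs.2.trans_lt hT⟩) hsub)
  obtain ⟨P, hP⟩ := ContinuousMap.exists_restrict_eq hK ⟨_, hQK.domRestrict⟩
  have hPQ : ∀ s ∈ Icc 0 T₁, ∀ x ∈ closedBall (0 : E3) R₁, P (s, x) = Q (s, x) := by
    intro s hs x hx
    exact DFunLike.congr_fun hP ⟨(s, x), hs, hx⟩
  have hd' : ∀ s ∈ Ioo 0 T, ∀ x ∈ ball (0 : E3) R, HasDerivAt (fun s => u s x) (Q (s, x)) s :=
    fun s hs x hx => (hd s ⟨hs.1.le, hs.2⟩ x hx).hasDerivAt (Ico_mem_nhds hs.1 hs.2)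
  have h0T : (0 : ℝ) ∈ Ico 0 T := ⟨le_rfl, h₁.trans hT⟩
  refine ⟨fun s x => P (s, x), P.continuous, ?_, ?_, ?_⟩
  · intro s hs x hx
    simp only
    rw [hPQ s ⟨hs.1.le, hs.2⟩ x hx]
    exact (hd' s ⟨hs.1, hs.2.trans_lt hT⟩ x (hsub hx)).deriv
  · intro x hx
    simp only
    rw [hPQ 0 ⟨le_rfl, h₁.le⟩ x hx]
    exact (uniqueDiffOn_Ico 0 T 0 h0T).eq_deriv _ (hd 0 h0T x (hsub hx))
      (h.initial_deriv x (hsub hx))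
  · intro s hs x hx
    have hc : ContinuousOn (fun s => u s x) (Icc 0 s) := fun τ hτ =>
      ((hd τ ⟨hτ.1, (hτ.2.trans hs.2).trans_lt hT⟩ x (hsub hx)).continuousWithinAt).mono
        fun y hy => ⟨hy.1, (hy.2.trans hs.2).trans_lt hT⟩
    have hPc : Continuous fun τ => P (τ, x) :=
      P.continuous.comp (by fun_prop : Continuous fun τ : ℝ => (τ, x))
    rw [intervalIntegral.integral_eq_sub_of_hasDerivAt_of_le hs.1 hc (fun τ hτ => ?_)
      (hPc.intervalIntegrable _ _), ← h.initial x (hsub hx)]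
    · ring
    · rw [hPQ τ ⟨hτ.1.le, hτ.2.le.trans hs.2⟩ x hx]
      exact hd' τ ⟨hτ.1, hτ.2.trans_le (hs.2.trans hT.le)⟩ x (hsub hx)

/-- The spherical means `m` of `∂ₜ u` along the outgoing characteristic `r = t + q` satisfy an
integral inequality of Riccati type, with the free wave as the inhomogeneous term. -/
theorem IsJohnSolution.exists_riccati_mean {u₀ u₁ : E3 → ℝ} {u v : ℝ → E3 → ℝ} {T T₁ R ρ q : ℝ}
    {x₀ : E3} (h : IsJohnSolution (Ico 0 T) (ball 0 R) u₀ u₁ u) (hv : IsFreeWave u₀ u₁ v)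
    (h₁ : 0 < T₁) (hT : T₁ < T) (hq : 0 ≤ q) (hρ : 2 * T₁ + q < ρ) (hR : ‖x₀‖ + ρ < R) :
    ∃ m : ℝ → ℝ, Continuous m ∧
      (∀ t ∈ Ioo 0 T₁, ∃ x : E3, ‖x‖ ≤ ‖x₀‖ + (t + q) ∧ m t ≤ timeDeriv u t x) ∧
      ∀ t ∈ Ioo 0 T₁, (t + q) * sphericalMean x₀ (timeDeriv v t) (t + q) +
        2⁻¹ * ∫ s in (0 : ℝ)..t, (s + q) * m s ^ 2 ≤ (t + q) * m t := by
  obtain ⟨P, hPc, hPu, hP0, hPI⟩ := h.exists_continuous_timeDeriv h₁ hT hR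
  obtain ⟨hvc, hv0, hvI⟩ := hv.timeDeriv_spec
  have hball : ball x₀ ρ ⊆ closedBall 0 (‖x₀‖ + ρ) := fun x hx => by
    rw [mem_ball, dist_eq_norm] at hx
    rw [mem_closedBall_zero_iff]
    have := norm_add_le x₀ (x - x₀)
    rw [add_sub_cancel] at this
    linarith
  have hPs : ∀ s, Continuous (P s) := fun s =>
    hPc.comp (by fun_prop : Continuous fun x : E3 => (s, x))
  have hvs : ∀ s, Continuous (timeDeriv v s) := fun s =>
    hvc.comp (by fun_prop : Continuous fun x : E3 => (s, x))
  have hPi : ∀ x s, IntervalIntegrable (fun τ => P τ x) volume 0 s := fun x s =>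
    (hPc.comp (by fun_prop : Continuous fun τ : ℝ => (τ, x))).intervalIntegrable _ _
  have hvi : ∀ x s, IntervalIntegrable (fun τ => timeDeriv v τ x) volume 0 s := fun x s =>
    (hvc.comp (by fun_prop : Continuous fun τ : ℝ => (τ, x))).intervalIntegrable _ _
  have hmean : ∀ {g : ℝ → E3 → ℝ}, (Continuous fun z : ℝ × E3 => g z.1 z.2) →
      Continuous fun s => sphericalMean x₀ (g s) (s + q) := fun hg =>
    (continuous_sphericalMean hg x₀).comp (by fun_prop : Continuous fun s : ℝ => (s, s + q))
  have hrad : ∀ (t : ℝ) (ξ : sphere (0 : E3) 1), 0 < t → ‖(t + q) • (ξ : E3)‖ = t + q :=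
    fun t ξ ht => by simp [norm_smul, abs_of_nonneg (by linarith : 0 ≤ t + q)]
  refine ⟨fun s => sphericalMean x₀ (P s) (s + q), hmean hPc, fun t ht => ?_, fun t ht => ?_⟩
  · -- some value is at least the mean
    have hne : (volume : Measure E3).toSphere ≠ 0 := Measure.toSphere_ne_zero _
    obtain ⟨ξ, hξ⟩ := exists_average_le hne (integrable_sphere (hPs t) x₀ (t + q))
    have hn : ‖x₀ + (t + q) • (ξ : E3)‖ ≤ ‖x₀‖ + (t + q) :=
      (norm_add_le _ _).trans (by rw [hrad t ξ ht.1])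
    refine ⟨x₀ + (t + q) • (ξ : E3), hn, ?_⟩
    rw [hPu t ⟨ht.1, ht.2.le⟩ _ (by rw [mem_closedBall_zero_iff]; linarith [ht.1, ht.2])]
    refine le_trans (le_of_eq ?_) hξ
    rw [average_eq, sphere_measureReal_univ, smul_eq_mul]
    rfl
  · have key := mean_lower_bound (p := fun s x => P s x - timeDeriv v s x)
      (f := fun s x => P s x ^ 2) (T := T₁) (ρ := ρ) (x₀ := x₀) (hPc.sub hvc) (hPc.pow 2)
      (fun _ _ => sq_nonneg _)
      (fun x hx => by rw [hP0 x (hball hx), hv0, sub_self]) ?_ hq ht.1 ht.2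
      (by linarith [ht.2])
    · rw [sphericalMean_sub (hPs t) (hvs t)] at key
      have hJ : ∫ s in (0 : ℝ)..t, (s + q) * sphericalMean x₀ (P s) (s + q) ^ 2 ≤
          ∫ s in (0 : ℝ)..t, (s + q) * sphericalMean x₀ (fun x => P s x ^ 2) (s + q) := by
        refine intervalIntegral.integral_mono_on ht.1.le
          (Continuous.intervalIntegrable ?_ _ _) (Continuous.intervalIntegrable ?_ _ _)
          fun s hs => ?_
        · exact (by fun_prop : Continuous fun s : ℝ => s + q).mul ((hmean hPc).pow 2)
        · exact (by fun_prop : Continuous fun s : ℝ => s + q).mul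
            (hmean (g := fun s x => P s x ^ 2) (hPc.pow 2))
        · exact mul_le_mul_of_nonneg_left (sq_sphericalMean_le (hPs s) x₀ (s + q))
            (by linarith [hs.1])
      simp only
      linarith
    · -- the difference of the solution and the free wave solves the inhomogeneous equation
      intro φ hφ hφc hφs
      have hwc := continuous_waveOp hφ
      have hwcs : HasCompactSupport fun z : ℝ × E3 => waveOp φ z.1 z.2 :=
        HasCompactSupport.intro hφc fun z hz => waveOp_eq_zero_of_notMem_tsupport hz
      have hin : ∀ z ∈ tsupport (fun z : ℝ × E3 => φ z.1 z.2),
          z.1 ∈ Ioo 0 T₁ ∧ z.2 ∈ closedBall (0 : E3) (‖x₀‖ + ρ) := fun z hz =>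
        ⟨(hφs hz).1, hball (hφs hz).2⟩
      set U : ℝ × E3 → ℝ := fun z => v z.1 z.2 +
        ∫ τ in (0 : ℝ)..z.1, (P τ z.2 - timeDeriv v τ z.2) with hU
      have hvcont : Continuous fun z : ℝ × E3 => v z.1 z.2 := by
        have := IsWaveSolution.contDiffOn hv
        rw [univ_prod_univ, contDiffOn_univ] at this
        exact this.continuous
      have hIc : Continuous fun z : ℝ × E3 =>
          ∫ τ in (0 : ℝ)..z.1, (P τ z.2 - timeDeriv v τ z.2) := by
        have := intervalIntegral.continuous_parametric_primitive_of_continuous (μ := volume)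
          (a₀ := 0) (f := fun (x : E3) (τ : ℝ) => P τ x - timeDeriv v τ x)
          ((hPc.sub hvc).comp (by fun_prop : Continuous fun z : E3 × ℝ => (z.2, z.1)))
        exact this.comp (by fun_prop : Continuous fun z : ℝ × E3 => (z.2, z.1))
      have hUu : ∀ z ∈ tsupport (fun z : ℝ × E3 => φ z.1 z.2), U z = u z.1 z.2 := fun z hz => by
        obtain ⟨h1, h2⟩ := hin z hz
        simp only [hU]
        rw [hPI z.1 ⟨h1.1.le, h1.2.le⟩ z.2 h2, hvI z.1 z.2,
          intervalIntegral.integral_sub (hPi _ _) (hvi _ _)]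
        ring
      have e1 := IsWaveSolution.equation h φ hφ hφc (hφs.trans (by
        rw [interior_Ico, isOpen_ball.interior_eq]
        exact prod_mono (Ioo_subset_Ioo_right hT.le) (hball.trans (closedBall_subset_ball hR))))
      have e2 := IsWaveSolution.equation hv φ hφ hφc (by simp)
      have e1' : ∫ z : ℝ × E3, U z * waveOp φ z.1 z.2 =
          ∫ z : ℝ × E3, P z.1 z.2 ^ 2 * φ z.1 z.2 := by
        refine (integral_congr_ae (.of_forall fun z => ?_)).trans
          (e1.trans (integral_congr_ae (.of_forall fun z => ?_)))
        · by_cases hz : z ∈ tsupport (fun z : ℝ × E3 => φ z.1 z.2)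
          · simp only [hUu z hz]
          · simp only [waveOp_eq_zero_of_notMem_tsupport hz, mul_zero]
        · by_cases hz : z ∈ tsupport (fun z : ℝ × E3 => φ z.1 z.2)
          · obtain ⟨h1, h2⟩ := hin z hz
            simp only [hPu z.1 ⟨h1.1, h1.2.le⟩ z.2 h2]
          · have : φ z.1 z.2 = 0 := image_eq_zero_of_notMem_tsupport
              (f := fun z : ℝ × E3 => φ z.1 z.2) hz
            simp only [this, mul_zero]
      have e3 : ∫ z : ℝ × E3, U z * waveOp φ z.1 z.2 =
          (∫ z : ℝ × E3, v z.1 z.2 * waveOp φ z.1 z.2) +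
          ∫ z : ℝ × E3, (∫ τ in (0 : ℝ)..z.1, (P τ z.2 - timeDeriv v τ z.2)) *
            waveOp φ z.1 z.2 := by
        have i1 : Integrable fun z : ℝ × E3 => v z.1 z.2 * waveOp φ z.1 z.2 :=
          (hvcont.mul hwc).integrable_of_hasCompactSupport hwcs.mul_left
        have i2 : Integrable fun z : ℝ × E3 =>
            (∫ τ in (0 : ℝ)..z.1, (P τ z.2 - timeDeriv v τ z.2)) * waveOp φ z.1 z.2 :=
          (hIc.mul hwc).integrable_of_hasCompactSupport hwcs.mul_left
        rw [← integral_add i1 i2]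
        exact integral_congr_ae (.of_forall fun z => by simp only [hU]; ring)
      rw [e2, e1'] at e3
      simp only [zero_mul, integral_zero, zero_add] at e3
      exact e3.symm

/-! ### Blow-up of the Riccati inequality -/

/-- A continuous `m` with `δ + ½ ∫ₐᵗ (s + q) m² ≤ (t + q) m` grows at least as the solution
`y = (1/δ - ½ log ((t + q) / (a + q)))⁻¹` of `y' = y² / (2 (t + q))`, `y a = δ`, which exists as
long as `m` does. -/
theorem riccati_lower_bound {m : ℝ → ℝ} (hm : Continuous m) {q a T δ : ℝ} (haq : 0 < a + q)
    (hδ : 0 < δ)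
    (h : ∀ t ∈ Ico a T, δ + 2⁻¹ * ∫ s in a..t, (s + q) * m s ^ 2 ≤ (t + q) * m t)
    {t : ℝ} (ht : t ∈ Ico a T) :
    0 < δ⁻¹ - 2⁻¹ * Real.log ((t + q) / (a + q)) ∧
      (δ⁻¹ - 2⁻¹ * Real.log ((t + q) / (a + q)))⁻¹ ≤ (t + q) * m t := by
  set y : ℝ → ℝ := fun t => δ + 2⁻¹ * ∫ s in a..t, (s + q) * m s ^ 2 with hy
  have hc : Continuous fun s => (s + q) * m s ^ 2 := by fun_prop
  have hyd : ∀ t, HasDerivAt y (2⁻¹ * ((t + q) * m t ^ 2)) t := fun t =>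
    ((intervalIntegral.integral_hasDerivAt_right (hc.intervalIntegrable _ _)
      hc.aestronglyMeasurable.stronglyMeasurableAtFilter hc.continuousAt).const_mul _).const_add _
  have hypos : ∀ s, a ≤ s → 0 < y s := fun s hs => by
    have : 0 ≤ ∫ s in a..s, (s + q) * m s ^ 2 :=
      intervalIntegral.integral_nonneg hs fun r hr =>
        mul_nonneg (by linarith [hr.1]) (sq_nonneg _)
    simp only [hy]; linarith
  -- constant along the comparison solution, decreasing along `y`
  set φ : ℝ → ℝ := fun s => (y s)⁻¹ + 2⁻¹ * Real.log ((s + q) / (a + q)) with hφ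
  have hφd : ∀ s, a ≤ s → HasDerivAt φ
      (-(2⁻¹ * ((s + q) * m s ^ 2)) / y s ^ 2 + 2⁻¹ * (s + q)⁻¹) s := fun s hs => by
    have hsq : 0 < s + q := by linarith
    have h1 : HasDerivAt (fun s => (s + q) / (a + q)) (1 / (a + q)) s :=
      ((hasDerivAt_id s).add_const q).div_const _
    have h2 := h1.log (div_pos hsq haq).ne'
    refine (((hyd s).inv (hypos s hs).ne').add (h2.const_mul 2⁻¹)).congr_deriv ?_
    field_simp
  have hanti : AntitoneOn φ (Icc a t) := by
    refine antitoneOn_of_deriv_nonpos (convex_Icc a t)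
      (fun s hs => (hφd s hs.1).continuousAt.continuousWithinAt)
      (fun s hs => ?_) fun s hs => ?_
    · rw [interior_Icc] at hs
      exact (hφd s hs.1.le).differentiableAt.differentiableWithinAt
    · rw [interior_Icc] at hs
      have hsq : 0 < s + q := by linarith [hs.1]
      have hyp := hypos s hs.1.le
      have hle : y s ≤ (s + q) * m s := h s ⟨hs.1.le, hs.2.trans ht.2⟩
      have hsq2 : y s ^ 2 ≤ ((s + q) * m s) ^ 2 := pow_le_pow_left₀ hyp.le hle 2
      rw [(hφd s hs.1.le).deriv]
      have : (s + q)⁻¹ ≤ (s + q) * m s ^ 2 / y s ^ 2 := by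
        rw [inv_eq_one_div, div_le_div_iff₀ hsq (by positivity)]
        linarith
      have e : -(2⁻¹ * ((s + q) * m s ^ 2)) / y s ^ 2 + 2⁻¹ * (s + q)⁻¹ =
          2⁻¹ * ((s + q)⁻¹ - (s + q) * m s ^ 2 / y s ^ 2) := by ring
      rw [e]
      linarith
  have h1 := hanti (left_mem_Icc.2 ht.1) (right_mem_Icc.2 ht.1) ht.1
  have ha : φ a = δ⁻¹ := by simp [hφ, hy, div_self haq.ne']
  rw [ha] at h1
  have hyt := hypos t ht.1
  have h2 : (y t)⁻¹ ≤ δ⁻¹ - 2⁻¹ * Real.log ((t + q) / (a + q)) := by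
    simp only [hφ] at h1; linarith
  have h3 : 0 < (y t)⁻¹ := inv_pos.2 hyt
  exact ⟨h3.trans_le h2, (inv_le_of_inv_le₀ hyt h2).trans (h t ht)⟩

/-! ### Blow-up in both time directions -/

/-- From time `a + 1` on, where the sign condition holds during `[a, a + 1]`, the Riccati inequality
has a positive constant term `δ` that depends only on the free wave. `Ts` is the blow-up time of the
comparison function; the bound `b` is the free-wave mean before time `a + 1` and the comparison
function, divided by `r = t + q`, afterwards. -/
theorem blowsUpForward_of_forwardSign {u₀ u₁ : E3 → ℝ} {v : ℝ → E3 → ℝ}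
    (hv : IsFreeWave u₀ u₁ v) (hsign : ForwardSign v) : BlowsUpForward u₀ u₁ := by
  obtain ⟨x₀, q, hq, r₀, hr₀, hpos⟩ := hsign
  obtain ⟨hvc, -, -⟩ := hv.timeDeriv_spec
  -- the means of the free wave along the characteristic `r = t + q`, positive from time `a` on
  set M : ℝ → ℝ := fun t => sphericalMean x₀ (timeDeriv v t) (t + q) with hM
  have hMc : Continuous M :=
    (continuous_sphericalMean hvc x₀).comp (by fun_prop : Continuous fun s : ℝ => (s, s + q))
  set a : ℝ := r₀ - q + 1 with ha
  have ha0 : 0 < a := by linarith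
  have hMpos : ∀ t, a ≤ t → 0 < M t := fun t ht => by
    have := hpos (t + q) (by linarith)
    rwa [add_sub_cancel_right] at this
  -- what the free wave contributes to the nonlinear term during `[a, a + 1]`
  set δ : ℝ := 2⁻¹ * ∫ s in a..(a + 1), (s + q) * M s ^ 2 with hδ
  have hMi : Continuous fun s => (s + q) * M s ^ 2 := by fun_prop
  have hδ0 : 0 < δ := by
    have := intervalIntegral.intervalIntegral_pos_of_pos_on
      (hMi.intervalIntegrable a (a + 1)) (fun s hs =>
        mul_pos (by linarith [hs.1]) (pow_pos (hMpos s hs.1.le) 2)) (by linarith)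
    rw [hδ]; linarith
  have haq : 0 < a + 1 + q := by linarith
  set lam : ℝ → ℝ := fun t => δ⁻¹ - 2⁻¹ * Real.log ((t + q) / (a + 1 + q)) with hlam
  -- the time at which the comparison function `lam⁻¹` becomes infinite
  set Ts : ℝ := (a + 1 + q) * Real.exp (2 / δ) - q with hTs
  have haTs : a + 1 < Ts := by
    have h1 : 1 < Real.exp (2 / δ) := Real.one_lt_exp_iff.2 (by positivity)
    have := mul_lt_mul_of_pos_left h1 haq
    rw [hTs]; linarith
  have hTs0 : 0 < Ts := by linarith
  have hlamTs : lam Ts = 0 := by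
    simp only [hlam, hTs, sub_add_cancel]
    rw [mul_div_cancel_left₀ _ haq.ne', Real.log_exp]
    field_simp
    norm_num
  set ρ : ℝ := 2 * Ts + q + 1 with hρ
  have hmain : ∀ (T : ℝ) (u : ℝ → E3 → ℝ),
      IsJohnSolution (Ico 0 T) (ball 0 (‖x₀‖ + ρ + 1)) u₀ u₁ u → ∀ t, 0 < t → t < T →
      t < Ts + 1 / 2 → ∃ x : E3, ‖x‖ ≤ ‖x₀‖ + (t + q) ∧ M t ≤ timeDeriv u t x ∧
        (a + 1 ≤ t → 0 < lam t ∧ (lam t)⁻¹ / (t + q) ≤ timeDeriv u t x) := by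
    intro T u hu t ht htT htTs
    obtain ⟨T₁, h1, h2⟩ := exists_between (lt_min htT htTs)
    rw [lt_min_iff] at h2
    obtain ⟨m, hmc, hmu, hmi⟩ := hu.exists_riccati_mean hv (ht.trans h1) h2.1 hq
      (ρ := ρ) (x₀ := x₀) (by linarith) (by linarith)
    have hmi' : Continuous fun s => (s + q) * m s ^ 2 := by fun_prop
    have hnn : ∀ b c, 0 ≤ b → b ≤ c → 0 ≤ ∫ s in b..c, (s + q) * m s ^ 2 := fun b c hb hbc =>
      intervalIntegral.integral_nonneg hbc fun s hs =>
        mul_nonneg (by linarith [hs.1]) (sq_nonneg _)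
    have hMm : ∀ s ∈ Ioo 0 T₁, M s ≤ m s := fun s hs => by
      refine le_of_mul_le_mul_left ?_ (by linarith [hs.1] : 0 < s + q)
      have := hnn 0 s le_rfl hs.1.le
      linarith [hmi s hs]
    obtain ⟨x, hx, hmx⟩ := hmu t ⟨ht, h1⟩
    refine ⟨x, hx, (hMm t ⟨ht, h1⟩).trans hmx, fun hat => ?_⟩
    have hric := riccati_lower_bound hmc (q := q) (a := a + 1) (T := T₁) haq hδ0
      (fun s hs => ?_) ⟨hat, h1⟩
    · refine ⟨hric.1, le_trans ?_ hmx⟩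
      rw [div_le_iff₀ (by linarith), mul_comm]
      exact hric.2
    · have hs0 : 0 < s := by linarith [hs.1]
      refine le_trans ?_ (hmi s ⟨hs0, hs.2⟩)
      have hi := fun b c => hmi'.intervalIntegrable (μ := volume) b c
      have e1 := intervalIntegral.integral_add_adjacent_intervals (hi 0 a) (hi a (a + 1))
      have e2 := intervalIntegral.integral_add_adjacent_intervals (hi 0 (a + 1)) (hi (a + 1) s)
      have e3 := hnn 0 a le_rfl ha0.le
      have e4 : ∫ s in a..(a + 1), (s + q) * M s ^ 2 ≤ ∫ s in a..(a + 1), (s + q) * m s ^ 2 := by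
        refine intervalIntegral.integral_mono_on (by linarith) (hMi.intervalIntegrable _ _)
          (hi _ _) fun r hr => ?_
        have hr0 : 0 < r := by linarith [hr.1]
        exact mul_le_mul_of_nonneg_left (pow_le_pow_left₀ (hMpos r hr.1).le
          (hMm r ⟨hr0, by linarith [hr.2, hs.1, hs.2]⟩) 2) (by linarith)
      have e5 : 0 < (s + q) * M s := mul_pos (by linarith) (hMpos s (by linarith [hs.1]))
      simp only [hM] at e5
      linarith
  set b : ℝ → ℝ := fun t => if t < a + 1 then M t else (lam t)⁻¹ / (t + q) with hb
  have hbtop : Tendsto b (𝓝[<] Ts) atTop := by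
    have hcl : ContinuousAt lam Ts := by
      have : (Ts + q) / (a + 1 + q) ≠ 0 := (div_pos (by linarith) haq).ne'
      simp only [hlam]
      fun_prop (disch := assumption)
    have hlpos : ∀ t ∈ Ioo (a + 1) Ts, 0 < lam t := fun t ht => by
      have h1 : Real.log ((t + q) / (a + 1 + q)) < Real.log ((Ts + q) / (a + 1 + q)) :=
        Real.log_lt_log (div_pos (by linarith [ht.1]) haq)
          (div_lt_div_of_pos_right (by linarith [ht.2]) haq)
      simp only [hlam] at hlamTs ⊢
      linarith
    have h0 : Tendsto lam (𝓝[<] Ts) (𝓝[>] 0) := by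
      refine tendsto_nhdsWithin_iff.2 ⟨?_, ?_⟩
      · rw [← hlamTs]; exact hcl.tendsto.mono_left nhdsWithin_le_nhds
      · filter_upwards [Ioo_mem_nhdsLT haTs] with t ht using hlpos t ht
    have h1 : Tendsto (fun t => (t + q)⁻¹) (𝓝[<] Ts) (𝓝 (Ts + q)⁻¹) := by
      have : ContinuousAt (fun t => (t + q)⁻¹) Ts :=
        (by fun_prop : ContinuousAt (fun t => t + q) Ts).inv₀ (by linarith)
      exact this.tendsto.mono_left nhdsWithin_le_nhds
    have h2 := h0.inv_tendsto_nhdsGT_zero.atTop_mul_pos (inv_pos.2 (by linarith : 0 < Ts + q)) h1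
    refine h2.congr' ?_
    filter_upwards [Ioo_mem_nhdsLT haTs] with t ht
    simp only [hb, if_neg (not_lt.2 ht.1.le), div_eq_mul_inv, Pi.inv_apply]
  have hbu : ∀ (T : ℝ) (u : ℝ → E3 → ℝ),
      IsJohnSolution (Ico 0 T) (ball 0 (‖x₀‖ + ρ + 1)) u₀ u₁ u → ∀ t, 0 < t → t < T → t < Ts →
      ∃ x : E3, ‖x‖ ≤ ‖x₀‖ + (t + q) ∧ b t ≤ timeDeriv u t x := by
    intro T u hu t ht htT htTs
    obtain ⟨x, hx, h1, h2⟩ := hmain T u hu t ht htT (by linarith)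
    refine ⟨x, hx, ?_⟩
    simp only [hb]
    split_ifs with h
    · exact h1
    · exact (h2 (not_lt.1 h)).2
  refine ⟨Ts, hTs0, ‖x₀‖ + ρ + 1, by positivity, b, hbtop, fun T u hT hu => ?_, fun u hu => ?_⟩
  · have hle : T ≤ Ts := by
      by_contra! hlt
      obtain ⟨x, -, -, h2⟩ := hmain T u hu Ts hTs0 hlt (by linarith)
      exact (h2 haTs.le).1.ne' hlamTs
    refine ⟨hle, fun t ht => ?_⟩
    obtain ⟨x, hx, h1⟩ := hbu T u hu t ht.1 ht.2 (ht.2.trans_le hle)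
    exact ⟨x, by rw [mem_ball_zero_iff]; linarith [ht.2], h1⟩
  · have hex : ∀ t, ∃ x : E3, t ∈ Ioo 0 Ts →
        ‖x‖ ≤ ‖x₀‖ + (t + q) ∧ b t ≤ timeDeriv u t x := fun t => by
      by_cases ht : t ∈ Ioo 0 Ts
      · obtain ⟨x, hx⟩ := hbu Ts u hu t ht.1 ht.2 ht.2
        exact ⟨x, fun _ => hx⟩
      · exact ⟨0, fun h => absurd h ht⟩
    choose X hX using hex
    -- an accumulation point of the points where `∂ₜ u` is large
    obtain ⟨y, hy, hcl⟩ := (isCompact_closedBall (0 : E3) (‖x₀‖ + (Ts + q))).exists_mapClusterPt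
      (f := 𝓝[<] Ts) (u := X) (by
        rw [le_principal_iff, mem_map]
        filter_upwards [Ioo_mem_nhdsLT hTs0] with t ht
        rw [mem_preimage, mem_closedBall_zero_iff]
        linarith [(hX t ht).1, ht.2])
    refine ⟨y, ?_, fun C => ?_⟩
    · rw [mem_closedBall_zero_iff] at hy
      rw [mem_ball_zero_iff]; linarith
    · intro hnot
      obtain ⟨A, hA, B, hB, hAB⟩ := eventually_prod_iff.1 hnot
      have hev : ∀ᶠ t in 𝓝[<] Ts, A t ∧ t ∈ Ioo 0 Ts ∧ C < b t := by
        filter_upwards [hA, Ioo_mem_nhdsLT hTs0, hbtop.eventually_gt_atTop C] with t h1 h2 h3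
        exact ⟨h1, h2, h3⟩
      have hfr : ∃ᶠ t in 𝓝[<] Ts, B (X t) := mapClusterPt_iff_frequently.1 hcl _ hB
      obtain ⟨t, hBt, hAt, ht, hCt⟩ := (hfr.and_eventually hev).exists
      exact hAB hAt hBt (hCt.trans_le (hX t ht).2)

theorem timeDeriv_comp_neg (u : ℝ → E3 → ℝ) (t : ℝ) (x : E3) :
    timeDeriv (fun t x => u (-t) x) t x = -timeDeriv u (-t) x :=
  deriv_comp_neg (fun s => u s x) t

/-- Time reversal maps solutions to solutions when the nonlinearity is even. -/
theorem IsWaveSolution.comp_neg {G : ℝ → ℝ} {I J : Set ℝ} {Ω : Set E3} {u₀ u₁ : E3 → ℝ}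
    {u : ℝ → E3 → ℝ} (h : IsWaveSolution G I Ω u₀ u₁ u) (hG : ∀ y, G (-y) = G y)
    (hJ : J = -I) :
    IsWaveSolution G J Ω u₀ (fun x => -u₁ x) (fun t x => u (-t) x) := by
  subst hJ
  have hneg : ∀ (φ : ℝ → E3 → ℝ) (t : ℝ) (x : E3),
      waveOp (fun t x => φ (-t) x) t x = waveOp φ (-t) x := fun φ t x => by
    simp only [waveOp]
    rw [iteratedDeriv_comp_neg 2 (fun s => φ s x) t]
    simp
  have hmp : MeasurePreserving (fun z : ℝ × E3 => (-z.1, z.2)) :=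
    (Measure.measurePreserving_neg (volume : Measure ℝ)).prod (MeasurePreserving.id _)
  have hemb : MeasurableEmbedding (fun z : ℝ × E3 => (-z.1, z.2)) :=
    ((Homeomorph.neg ℝ).prodCongr (Homeomorph.refl E3)).measurableEmbedding
  have hcd : ContDiff ℝ ∞ (fun z : ℝ × E3 => (-z.1, z.2)) := by fun_prop
  refine ⟨?_, fun φ hφ hφc hφs => ?_, fun x hx => ?_, fun x hx => ?_⟩
  · exact h.contDiffOn.comp (hcd.of_le (by simp)).contDiffOn fun z hz => ⟨hz.1, hz.2⟩
  · have hts : tsupport (fun z : ℝ × E3 => φ (-z.1) z.2) =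
        (fun z : ℝ × E3 => (-z.1, z.2)) ⁻¹' tsupport (fun z : ℝ × E3 => φ z.1 z.2) :=
      tsupport_comp_eq_preimage (fun z : ℝ × E3 => φ z.1 z.2)
        ((Homeomorph.neg ℝ).prodCongr (Homeomorph.refl E3))
    have key := h.equation (fun t x => φ (-t) x) (hφ.comp hcd)
      (hφc.comp_homeomorph ((Homeomorph.neg ℝ).prodCongr (Homeomorph.refl E3))) (by
        rw [hts]
        intro z hz
        obtain ⟨h1, h2⟩ := hφs hz
        refine ⟨?_, h2⟩
        have := (Homeomorph.neg ℝ).preimage_interior I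
        have h3 : -z.1 ∈ interior ((Homeomorph.neg ℝ) ⁻¹' I) := h1
        rw [← this] at h3
        simpa using h3)
    simp only [hneg] at key
    rw [← hmp.integral_comp hemb fun z : ℝ × E3 => u z.1 z.2 * waveOp φ (-z.1) z.2,
      ← hmp.integral_comp hemb fun z : ℝ × E3 => G (timeDeriv u z.1 z.2) * φ (-z.1) z.2] at key
    simp only [neg_neg] at key
    simp only [timeDeriv_comp_neg, hG]
    exact key
  · simpa using h.initial x hx
  · have h1 : HasDerivWithinAt (fun t => u t x) (u₁ x) I (-0) := by
      simpa using h.initial_deriv x hx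
    have h2 := h1.scomp (0 : ℝ) (hasDerivAt_neg (0 : ℝ)).hasDerivWithinAt
      (s := -I) (fun t ht => ht)
    simpa [Function.comp_def] using h2

theorem blowsUpBackward_of_blowsUpForward {u₀ u₁ : E3 → ℝ}
    (h : BlowsUpForward u₀ (fun x => -u₁ x)) : BlowsUpBackward u₀ u₁ := by
  obtain ⟨Ts, hTs, R, hR, b, hb, h1, h2⟩ := h
  have hrev : ∀ (T : ℝ) (u : ℝ → E3 → ℝ), IsJohnSolution (Ioc (-T) 0) (ball 0 R) u₀ u₁ u →
      IsJohnSolution (Ico 0 T) (ball 0 R) u₀ (fun x => -u₁ x) (fun t x => u (-t) x) :=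
    fun T u hu => IsWaveSolution.comp_neg hu (fun y => by ring) (by simp)
  have hneg : Tendsto (fun t : ℝ => -t) (𝓝[>] (-Ts)) (𝓝[<] Ts) := by
    simpa using tendsto_neg_nhdsGT (a := -Ts)
  have hneg' : Tendsto (fun t : ℝ => -t) (𝓝[<] Ts) (𝓝[>] (-Ts)) := tendsto_neg_nhdsLT
  refine ⟨Ts, hTs, R, hR, fun t => -b (-t), tendsto_neg_atTop_atBot.comp (hb.comp hneg),
    fun T u hT hu => ?_, fun u hu => ?_⟩
  · obtain ⟨hle, hx⟩ := h1 T _ hT (hrev T u hu)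
    refine ⟨hle, fun t ht => ?_⟩
    obtain ⟨x, hxR, hbx⟩ := hx (-t) ⟨by linarith [ht.2], by linarith [ht.1]⟩
    rw [timeDeriv_comp_neg, neg_neg] at hbx
    exact ⟨x, hxR, by linarith⟩
  · obtain ⟨y, hy, hf⟩ := h2 _ (hrev Ts u hu)
    refine ⟨y, hy, fun C => ?_⟩
    have hmap : Tendsto (fun z : ℝ × E3 => (-z.1, z.2)) (𝓝[<] Ts ×ˢ 𝓝 y)
        (𝓝[>] (-Ts) ×ˢ 𝓝 y) := hneg'.prodMap tendsto_id
    refine hmap.frequently ((hf (-C)).mono fun z hz => ?_)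
    rw [timeDeriv_comp_neg] at hz
    simp only
    linarith

theorem ForwardSign.of_backwardSign {v : ℝ → E3 → ℝ} (h : BackwardSign v) :
    ForwardSign (fun t x => v (-t) x) := by
  obtain ⟨x₀, q, hq, r₀, hr, hneg⟩ := h
  refine ⟨x₀, q, hq, r₀, hr, fun r hr' => ?_⟩
  have htd : timeDeriv (fun t x => v (-t) x) (r - q) = fun x => -timeDeriv v (-(r - q)) x :=
    funext fun x => timeDeriv_comp_neg v (r - q) x
  have := hneg r hr'
  rw [htd]
  simp only [sphericalMean, integral_neg, mul_neg] at this ⊢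
  linarith

theorem theorem3 (u₀ u₁ : E3 → ℝ) (hu₀ : ContDiff ℝ 2 u₀) (hu₁ : ContDiff ℝ 2 u₁)
    (hdecay : DataDecay u₀ u₁) (ulin : ℝ → E3 → ℝ) (hlin : IsFreeWave u₀ u₁ ulin) :
    (ForwardSign ulin → BlowsUpForward u₀ u₁) ∧
      (BackwardSign ulin → BlowsUpBackward u₀ u₁) := by
  refine ⟨blowsUpForward_of_forwardSign hlin, fun h => blowsUpBackward_of_blowsUpForward ?_⟩
  exact blowsUpForward_of_forwardSign
    (IsWaveSolution.comp_neg hlin (fun _ => rfl) (by simp)) (.of_backwardSign h)
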